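/- Let $X\neq\{0\}$ be a separable real Banach space. A type on $X$ is a function $\tau:X\to[0,\infty)$ of the form $\tau(z)=\lim_n\|z+x_n\|$ (for all $z\in X$) with a sequence $(x_n)$ in $X$; one says that $(x_n)$ determines $\tau$. Let $\mathcal F_X$ be the set of all types, with the topology of pointwise convergence on $X$, and let $F_X=\mathcal F_X\cup\{\sigma_\infty\}$ be its Alexandroff (one-point) compactification; $\sigma_\infty$ is called the infinite type. Write $\tau_x(z)=\|z+x\|$ for $x\in X$, $(-\sigma)(z)=\sigma(-z)$ for $\sigma\in\mathcal F_X$, and $-\sigma_\infty=\sigma_\infty$. Assume that $X$ is stable, i.e. $\lim_n\lim_m\|x_n+y_m\|=\lim_m\lim_n\|x_n+y_m\|$ whenever $(x_n)$ and $(y_m)$ determine types. For types $\sigma,\tau$ determined by $(x_n)$, $(y_m)$ let $\sigma*\tau$ be the type $(\sigma*\tau)(z)=\lim_n\lim_m\|z+x_n+y_m\|$, which does not depend on the choice of the determining sequences. Let $\mathcal M(X)$ be the space of finite signed (Radon) measures on $X$ with the total variation norm, $C_b(X)$ the space of bounded continuous real functions on $X$ with the sup norm, and $\Phi:\mathcal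 M(X)\to C_b(X)$, $\Phi(\mu)(y)=\int_X e^{-\|x-y\|}\,\mu(dx)$. Put $A_0=\Phi(\mathcal M(X))$ with the quotient norm $\|f\|_{A_0}=\inf\{\|\mu\|:\Phi(\mu)=f\}$ and $A_1=C_b(X)$. Let $0<\theta<1$, $1<p<\infty$, and let $R=[A_0,A_1]_{\theta,p}$ be the Lions--Peetre interpolation space: the space of all $z\in A_1$ that can be written $z=x_1(t)+x_2(t)$ for all $t\in\mathbb R$ with $e^{\theta t}x_1(t)\in L_p(\mathbb R;A_0)$ and $e^{-(1-\theta)t}x_2(t)\in L_p(\mathbb R;A_1)$, with the norm $\inf\,\|e^{\theta t}x_1(t)\|_{p}^{1-\theta}\,\|e^{-(1-\theta)t}x_2(t)\|_{p}^{\theta}$ over all such representations. The translations $T_xf(z)=f(z-x)$ $(x\in X)$ and the symmetrization $Sf(z)=f(-z)$ act on $R$ as linear isometries; let $G=\{T_x:x\in X\}$, and let $\widetilde G$ be the closure of $G$ in the space of bounded linear operators on $R$ for the weak operator topology. Then there is a homeomorphism $\sigma\mapsto T_\sigma$ from $F_X$ onto $\widetilde G$ (with the weak operator topology), with $T_{\tau_x}=T_x$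 for all $x\in X$, such that 1. for $\sigma\in F_X$, $T_\sigma=0$ if and only if $\sigma=\sigma_\infty$; 2. $S\circ T_{-\sigma}=T_\sigma\circ S$ for all $\sigma\in F_X$; 3. $T_{\sigma*\tau}=T_{\tau*\sigma}=T_\sigma\circ T_\tau$ for all types $\sigma,\tau\in\mathcal F_X$. -/

import Mathlib

open Filter Topology MeasureTheory

open scoped BoundedContinuousFunction ENNReal

noncomputable section

namespace StableBanach

/-! ### Types on a normed space, stability, convolution -/

section Types

variable {X : Type*} [NormedAddCommGroup X]

/-- The sequence `x` determines the function `τ`: `τ z = lim ‖z + x n‖` for every `z`. -/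
def Determines (x : ℕ → X) (τ : X → ℝ) : Prop :=
  ∀ z, Tendsto (fun n => ‖z + x n‖) atTop (𝓝 (τ z))

variable (X) in
/-- The space of types on a (separable) normed space: all functions determined by a sequence, with
the topology of pointwise convergence on `X`. -/
abbrev TypeSpace : Type _ := {τ : X → ℝ // ∃ x : ℕ → X, Determines x τ}

variable (X) in
/-- Stability: for type determining sequences `x`, `y`, the two iterated limits of `‖x n + y m‖`
agree (whenever both exist; since one may pass to subsequences, this is equivalent to asking that
both exist and agree). -/
def IsStable : Prop :=
  ∀ (x y : ℕ → X), (∃ σ, Determines x σ) → (∃ τ, Determines y τ) →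
    ∀ (a b : ℕ → ℝ) (A B : ℝ),
      (∀ n, Tendsto (fun m => ‖x n + y m‖) atTop (𝓝 (a n))) → Tendsto a atTop (𝓝 A) →
      (∀ m, Tendsto (fun n => ‖x n + y m‖) atTop (𝓝 (b m))) → Tendsto b atTop (𝓝 B) →
      A = B

/-- The degenerate type `z ↦ ‖z + x‖`. -/
def degenerate (x : X) : TypeSpace X :=
  ⟨fun z => ‖z + x‖, fun _ => x, fun _ => tendsto_const_nhds⟩

/-- The type `-σ`, i.e. `z ↦ σ (-z)`; it is determined by `-x n` if `σ` is determined by `x n`. -/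
instance : Neg (TypeSpace X) where
  neg σ := ⟨fun z => σ.1 (-z), by
    obtain ⟨x, hx⟩ := σ.2
    refine ⟨fun n => -x n, fun z => ?_⟩
    refine (hx (-z)).congr fun n => ?_
    rw [← norm_neg, neg_add, neg_neg]⟩

theorem Determines.abs_sub_le {x : ℕ → X} {τ : X → ℝ} (h : Determines x τ) (z w : X) :
    |τ z - τ w| ≤ ‖z - w‖ := by
  refine le_of_tendsto ((h z).sub (h w)).abs (Eventually.of_forall fun n => ?_)
  simpa using abs_norm_sub_norm_le (z + x n) (w + x n)

theorem Determines.bounded {x : ℕ → X} {τ : X → ℝ} (h : Determines x τ) :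
    ∃ C, ∀ n, ‖x n‖ ≤ C := by
  have h0 := h 0
  simp only [zero_add] at h0
  obtain ⟨C, hC⟩ := h0.bddAbove_range
  exact ⟨C, fun n => hC ⟨n, rfl⟩⟩

theorem Determines.translate {x : ℕ → X} {τ : X → ℝ} (h : Determines x τ) (z : X) :
    Determines (fun n => z + x n) (fun w => τ (w + z)) := fun w => by
  simpa [add_assoc] using h (w + z)

theorem Determines.subseq {x : ℕ → X} {τ : X → ℝ} (h : Determines x τ) {φ : ℕ → ℕ}
    (hφ : Tendsto φ atTop atTop) : Determines (fun n => x (φ n)) τ :=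
  fun w => (h w).comp hφ

theorem Determines.exists_bound {x y : ℕ → X} {σ τ : X → ℝ} (hx : Determines x σ)
    (hy : Determines y τ) : ∃ C, ∀ z n, |τ (z + x n)| ≤ |τ 0| + ‖z‖ + C := by
  obtain ⟨C, hC⟩ := hx.bounded
  refine ⟨C, fun z n => ?_⟩
  have h1 := hy.abs_sub_le (z + x n) 0
  have h2 := norm_add_le z (x n)
  have h3 := hC n
  have h4 := abs_sub_abs_le_abs_sub (τ (z + x n)) (τ 0)
  rw [sub_zero] at h1
  linarith

/-- On a stable space the iterated limits of `‖z + x n + y m‖` exist and do not depend on the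
determining sequences. -/
theorem exists_iterated_limit (hX : IsStable X) (σ τ : TypeSpace X) (z : X) :
    ∃ B : ℝ, ∀ x : ℕ → X, Determines x σ.1 →
      Tendsto (fun n => τ.1 (z + x n)) atTop (𝓝 B) := by
  obtain ⟨x₀, hx₀⟩ := σ.2
  obtain ⟨y, hy⟩ := τ.2
  obtain ⟨C, hC⟩ := hy.exists_bound hx₀
  obtain ⟨B, -, ψ, hψ, hB⟩ := tendsto_subseq_of_bounded
    (Metric.isBounded_closedBall (x := (0 : ℝ)) (r := |σ.1 0| + ‖z‖ + C))
    (x := fun m => σ.1 (z + y m)) (fun m => by simpa using hC z m)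
  refine ⟨B, fun x hx => tendsto_of_subseq_tendsto fun ns hns => ?_⟩
  obtain ⟨C', hC'⟩ := hx.exists_bound hy
  obtain ⟨A, -, φ, hφ, hA⟩ := tendsto_subseq_of_bounded
    (Metric.isBounded_closedBall (x := (0 : ℝ)) (r := |τ.1 0| + ‖z‖ + C'))
    (x := fun m => τ.1 (z + x (ns m))) (fun m => by simpa using hC' z (ns m))
  have hd := (hx.subseq (hns.comp hφ.tendsto_atTop))
  have hd' := hy.subseq hψ.tendsto_atTop
  have key := hX (fun n => z + x (ns (φ n))) (fun m => y (ψ m)) ⟨_, hd.translate z⟩ ⟨_, hd'⟩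
    (fun n => τ.1 (z + x (ns (φ n)))) (fun m => σ.1 (z + y (ψ m))) A B
    (fun n => hd' _) hA
    (fun m => (hd (z + y (ψ m))).congr fun n => by
      simp only [Function.comp_apply]; congr 1; abel) hB
  exact ⟨φ, key ▸ hA⟩

/-- On a separable stable space there is, for all types `σ`, `τ`, a type `ρ` such that
`ρ z = lim_n lim_m ‖z + x n + y m‖` for all `x` determining `σ` and all `y` determining `τ`. -/
theorem exists_conv [TopologicalSpace.SeparableSpace X] (hX : IsStable X) (σ τ : TypeSpace X) :
    ∃ ρ : TypeSpace X, ∀ x y : ℕ → X, Determines x σ.1 → Determines y τ.1 →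
      ∀ z, ∃ L : ℕ → ℝ, (∀ n, Tendsto (fun m => ‖z + x n + y m‖) atTop (𝓝 (L n))) ∧
        Tendsto L atTop (𝓝 (ρ.1 z)) := by
  choose ρ hρ using exists_iterated_limit hX σ τ
  suffices h : ∃ u : ℕ → X, Determines u ρ from
    ⟨⟨ρ, h⟩, fun x y hx hy z => ⟨fun n => τ.1 (z + x n), fun n => hy _, hρ z x hx⟩⟩
  obtain ⟨x, hx⟩ := σ.2
  obtain ⟨y, hy⟩ := τ.2
  have hex : ∀ k : ℕ, ∃ v : X, ∀ i ∈ Finset.range (k + 1),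
      |‖TopologicalSpace.denseSeq X i + v‖ - ρ (TopologicalSpace.denseSeq X i)| < 2 / (k + 1) := by
    intro k
    have hk : (0 : ℝ) < 1 / (k + 1) := by positivity
    have h1 : ∀ᶠ n in atTop, ∀ i ∈ Finset.range (k + 1),
        |τ.1 (TopologicalSpace.denseSeq X i + x n) - ρ (TopologicalSpace.denseSeq X i)|
          < 1 / (k + 1) := by
      rw [Finset.eventually_all]
      intro i _
      have := (hρ (TopologicalSpace.denseSeq X i) x hx)
      rw [Metric.tendsto_nhds] at this
      simpa [Real.dist_eq] using this _ hk
    obtain ⟨n, hn⟩ := h1.exists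
    have h2 : ∀ᶠ m in atTop, ∀ i ∈ Finset.range (k + 1),
        |‖TopologicalSpace.denseSeq X i + x n + y m‖ - τ.1 (TopologicalSpace.denseSeq X i + x n)|
          < 1 / (k + 1) := by
      rw [Finset.eventually_all]
      intro i _
      have := hy (TopologicalSpace.denseSeq X i + x n)
      rw [Metric.tendsto_nhds] at this
      simpa [Real.dist_eq] using this _ hk
    obtain ⟨m, hm⟩ := h2.exists
    refine ⟨x n + y m, fun i hi => ?_⟩
    have e1 := hn i hi
    have e2 := hm i hi
    rw [← add_assoc]
    have e3 := abs_sub_le ‖TopologicalSpace.denseSeq X i + x n + y m‖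
      (τ.1 (TopologicalSpace.denseSeq X i + x n)) (ρ (TopologicalSpace.denseSeq X i))
    have e4 : (2 : ℝ) / (k + 1) = 1 / (k + 1) + 1 / (k + 1) := by ring
    linarith
  choose u hu using hex
  have hρL : ∀ z w, |ρ z - ρ w| ≤ ‖z - w‖ := fun z w => by
    refine le_of_tendsto ((hρ z x hx).sub (hρ w x hx)).abs (Eventually.of_forall fun n => ?_)
    simpa using hy.abs_sub_le (z + x n) (w + x n)
  refine ⟨u, fun z => ?_⟩
  rw [Metric.tendsto_atTop]
  intro ε hε
  obtain ⟨_, ⟨i, rfl⟩, hi⟩ :=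
    Metric.mem_closure_iff.1 (TopologicalSpace.denseRange_denseSeq X z) (ε / 4) (by positivity)
  obtain ⟨N, hN⟩ := exists_nat_gt (8 / ε)
  refine ⟨max N i, fun k hk => ?_⟩
  have h1 := hu k i (Finset.mem_range.2 (by have := le_of_max_le_right hk; omega))
  have h2 : (2 : ℝ) / (k + 1) ≤ ε / 4 := by
    have hNk : (N : ℝ) ≤ k := by exact_mod_cast le_of_max_le_left hk
    rw [div_le_div_iff₀ (by positivity) (by norm_num)]
    rw [div_lt_iff₀ hε] at hN
    nlinarith
  have h3 := hρL z (TopologicalSpace.denseSeq X i)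
  have h4 : |‖z + u k‖ - ‖TopologicalSpace.denseSeq X i + u k‖| ≤
      ‖z - TopologicalSpace.denseSeq X i‖ := by
    simpa using abs_norm_sub_norm_le (z + u k) (TopologicalSpace.denseSeq X i + u k)
  rw [dist_eq_norm] at hi
  rw [Real.dist_eq]
  rw [abs_le] at h3 h4
  rw [abs_lt] at h1 ⊢
  constructor <;> linarith

/-- The convolution `σ ⋆ τ` of two types on a separable stable space,
`(σ ⋆ τ) z = lim_n lim_m ‖z + x n + y m‖`, where `x` determines `σ` and `y` determines `τ`. -/
def conv [TopologicalSpace.SeparableSpace X] (hX : IsStable X) (σ τ : TypeSpace X) : TypeSpace X :=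
  (exists_conv hX σ τ).choose

theorem conv_spec [TopologicalSpace.SeparableSpace X] (hX : IsStable X) (σ τ : TypeSpace X) (x y : ℕ → X)
    (hx : Determines x σ.1) (hy : Determines y τ.1) (z : X) :
    ∃ L : ℕ → ℝ, (∀ n, Tendsto (fun m => ‖z + x n + y m‖) atTop (𝓝 (L n))) ∧
      Tendsto L atTop (𝓝 ((conv hX σ τ).1 z)) :=
  (exists_conv hX σ τ).choose_spec x y hx hy z

variable (X) in
/-- The Alexandroff compactification of the space of types; the point `∞` is the infinite type. -/
abbrev CompactTypeSpace : Type _ := OnePoint (TypeSpace X)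

end Types

/-! ### Lions–Peetre interpolation spaces

`A₀` is embedded in `A₁` by `ι`, so that `A₀ + A₁ = A₁`. -/

section Interpolation

variable {A₀ A₁ : Type*} [NormedAddCommGroup A₀] [NormedSpace ℝ A₀]
  [NormedAddCommGroup A₁] [NormedSpace ℝ A₁]

/-- `z = x₁ t + x₂ t` for all real `t`, where `exp (θ t) x₁ t` is in `L_p (A₀)` and
`exp (-(1 - θ) t) x₂ t` is in `L_p (A₁)`. -/
structure IsRepr (ι : A₀ →L[ℝ] A₁) (θ : Set.Ioo (0 : ℝ) 1) (p : Set.Ioi (1 : ℝ)) (z : A₁)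
    (x₁ : ℝ → A₀) (x₂ : ℝ → A₁) : Prop where
  memLp₀ : MemLp (fun t => Real.exp (θ * t) • x₁ t) (ENNReal.ofReal p) volume
  memLp₁ : MemLp (fun t => Real.exp (-(1 - θ) * t) • x₂ t) (ENNReal.ofReal p) volume
  add_eq : ∀ t, ι (x₁ t) + x₂ t = z

/-- `‖exp (θ t) x₁ t‖_p`. -/
def lpNorm₀ (θ : Set.Ioo (0 : ℝ) 1) (p : Set.Ioi (1 : ℝ)) (x₁ : ℝ → A₀) : ℝ :=
  (eLpNorm (fun t => Real.exp (θ * t) • x₁ t) (ENNReal.ofReal p) volume).toReal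

/-- `‖exp (-(1 - θ) t) x₂ t‖_p`. -/
def lpNorm₁ (θ : Set.Ioo (0 : ℝ) 1) (p : Set.Ioi (1 : ℝ)) (x₂ : ℝ → A₁) : ℝ :=
  (eLpNorm (fun t => Real.exp (-(1 - θ) * t) • x₂ t) (ENNReal.ofReal p) volume).toReal

/-- The Lions–Peetre norm: the infimum, over all representations of `z`, of
`‖exp (θ t) x₁ t‖_p ^ (1 - θ) * ‖exp (-(1 - θ) t) x₂ t‖_p ^ θ`. -/
def lionsPeetreNorm (ι : A₀ →L[ℝ] A₁) (θ : Set.Ioo (0 : ℝ) 1) (p : Set.Ioi (1 : ℝ)) (z : A₁) : ℝ :=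
  sInf {r | ∃ x₁ x₂, IsRepr ι θ p z x₁ x₂ ∧
    r = lpNorm₀ θ p x₁ ^ (1 - θ : ℝ) * lpNorm₁ θ p x₂ ^ (θ : ℝ)}

variable {ι : A₀ →L[ℝ] A₁} {θ : Set.Ioo (0 : ℝ) 1} {p : Set.Ioi (1 : ℝ)}

theorem one_le_ofReal_exponent (p : Set.Ioi (1 : ℝ)) : 1 ≤ ENNReal.ofReal p := by
  rw [← ENNReal.ofReal_one]
  exact ENNReal.ofReal_le_ofReal p.2.le

theorem lpNorm₀_nonneg (x₁ : ℝ → A₀) : 0 ≤ lpNorm₀ θ p x₁ := ENNReal.toReal_nonneg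

theorem lpNorm₁_nonneg (x₂ : ℝ → A₁) : 0 ≤ lpNorm₁ θ p x₂ := ENNReal.toReal_nonneg

theorem IsRepr.zero : IsRepr ι θ p 0 0 0 where
  memLp₀ := by simp
  memLp₁ := by simp
  add_eq := by simp

theorem IsRepr.add {z w : A₁} {x₁ y₁ : ℝ → A₀} {x₂ y₂ : ℝ → A₁} (h : IsRepr ι θ p z x₁ x₂)
    (k : IsRepr ι θ p w y₁ y₂) : IsRepr ι θ p (z + w) (x₁ + y₁) (x₂ + y₂) where
  memLp₀ := by simpa [smul_add] using! h.memLp₀.add k.memLp₀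
  memLp₁ := by simpa only [Pi.add_apply, smul_add] using! h.memLp₁.add k.memLp₁
  add_eq t := by
    rw [← h.add_eq t, ← k.add_eq t, Pi.add_apply, Pi.add_apply, map_add]; abel

theorem IsRepr.smul {z : A₁} {x₁ : ℝ → A₀} {x₂ : ℝ → A₁} (h : IsRepr ι θ p z x₁ x₂) (c : ℝ) :
    IsRepr ι θ p (c • z) (c • x₁) (c • x₂) where
  memLp₀ := by simpa only [Pi.smul_def, smul_comm _ c] using! h.memLp₀.const_smul c
  memLp₁ := by simpa only [Pi.smul_def, smul_comm _ c] using! h.memLp₁.const_smul c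
  add_eq t := by rw [← h.add_eq t, smul_add, Pi.smul_apply, Pi.smul_apply, map_smul]

theorem IsRepr.lpNorm₀_add_le {z w : A₁} {x₁ y₁ : ℝ → A₀} {x₂ y₂ : ℝ → A₁}
    (h : IsRepr ι θ p z x₁ x₂) (k : IsRepr ι θ p w y₁ y₂) :
    lpNorm₀ θ p (x₁ + y₁) ≤ lpNorm₀ θ p x₁ + lpNorm₀ θ p y₁ := by
  unfold lpNorm₀
  rw [← ENNReal.toReal_add h.memLp₀.eLpNorm_ne_top k.memLp₀.eLpNorm_ne_top]
  refine ENNReal.toReal_mono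
    (ENNReal.add_ne_top.2 ⟨h.memLp₀.eLpNorm_ne_top, k.memLp₀.eLpNorm_ne_top⟩) ?_
  simpa only [Pi.add_def, smul_add] using!
    eLpNorm_add_le h.memLp₀.1 k.memLp₀.1 (one_le_ofReal_exponent p)

theorem IsRepr.lpNorm₁_add_le {z w : A₁} {x₁ y₁ : ℝ → A₀} {x₂ y₂ : ℝ → A₁}
    (h : IsRepr ι θ p z x₁ x₂) (k : IsRepr ι θ p w y₁ y₂) :
    lpNorm₁ θ p (x₂ + y₂) ≤ lpNorm₁ θ p x₂ + lpNorm₁ θ p y₂ := by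
  unfold lpNorm₁
  rw [← ENNReal.toReal_add h.memLp₁.eLpNorm_ne_top k.memLp₁.eLpNorm_ne_top]
  refine ENNReal.toReal_mono
    (ENNReal.add_ne_top.2 ⟨h.memLp₁.eLpNorm_ne_top, k.memLp₁.eLpNorm_ne_top⟩) ?_
  simpa only [Pi.add_def, smul_add] using!
    eLpNorm_add_le h.memLp₁.1 k.memLp₁.1 (one_le_ofReal_exponent p)

theorem lpNorm₀_smul (c : ℝ) (x₁ : ℝ → A₀) : lpNorm₀ θ p (c • x₁) = |c| * lpNorm₀ θ p x₁ := by
  unfold lpNorm₀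
  have : (fun t => Real.exp (θ * t) • (c • x₁) t) = c • fun t => Real.exp (θ * t) • x₁ t := by
    ext t; simp only [Pi.smul_apply]; rw [smul_comm]
  rw [this, eLpNorm_const_smul, ENNReal.toReal_mul]
  simp

theorem lpNorm₁_smul (c : ℝ) (x₂ : ℝ → A₁) : lpNorm₁ θ p (c • x₂) = |c| * lpNorm₁ θ p x₂ := by
  unfold lpNorm₁
  have : (fun t => Real.exp (-(1 - θ) * t) • (c • x₂) t) =
      c • fun t => Real.exp (-(1 - θ) * t) • x₂ t := by
    ext t; simp only [Pi.smul_apply]; rw [smul_comm]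
  rw [this, eLpNorm_const_smul, ENNReal.toReal_mul]
  simp

/-- Translating the parameter of a representation by `s` multiplies the two norms by
`exp (-θ s)` and `exp ((1 - θ) s)`. -/
theorem IsRepr.shift {z : A₁} {x₁ : ℝ → A₀} {x₂ : ℝ → A₁} (h : IsRepr ι θ p z x₁ x₂) (s : ℝ) :
    IsRepr ι θ p z (fun t => x₁ (t + s)) (fun t => x₂ (t + s)) ∧
      lpNorm₀ θ p (fun t => x₁ (t + s)) = Real.exp (-θ * s) * lpNorm₀ θ p x₁ ∧
      lpNorm₁ θ p (fun t => x₂ (t + s)) = Real.exp ((1 - θ) * s) * lpNorm₁ θ p x₂ := by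
  have hs := measurePreserving_add_right (volume : Measure ℝ) s
  have e₀ : (fun t => Real.exp (θ * t) • x₁ (t + s)) =
      Real.exp (-θ * s) • ((fun t => Real.exp (θ * t) • x₁ t) ∘ fun t => t + s) := by
    ext t
    simp only [Pi.smul_apply, Function.comp_apply, smul_smul, ← Real.exp_add]
    congr 2; ring
  have e₁ : (fun t => Real.exp (-(1 - θ) * t) • x₂ (t + s)) =
      Real.exp ((1 - θ) * s) • ((fun t => Real.exp (-(1 - θ) * t) • x₂ t) ∘ fun t => t + s) := by
    ext t
    simp only [Pi.smul_apply, Function.comp_apply, smul_smul, ← Real.exp_add]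
    congr 2; ring
  refine ⟨⟨?_, ?_, fun t => h.add_eq _⟩, ?_, ?_⟩
  · rw [e₀]; exact (h.memLp₀.comp_measurePreserving hs).const_smul _
  · rw [e₁]; exact (h.memLp₁.comp_measurePreserving hs).const_smul _
  · unfold lpNorm₀
    rw [e₀, eLpNorm_const_smul, eLpNorm_comp_measurePreserving h.memLp₀.1 hs, ENNReal.toReal_mul]
    simp [Real.abs_exp]
  · unfold lpNorm₁
    rw [e₁, eLpNorm_const_smul, eLpNorm_comp_measurePreserving h.memLp₁.1 hs, ENNReal.toReal_mul]
    simp [Real.abs_exp]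

theorem lionsPeetreNorm_nonneg (z : A₁) : 0 ≤ lionsPeetreNorm ι θ p z := by
  refine Real.sInf_nonneg ?_
  rintro r ⟨x₁, x₂, -, rfl⟩
  exact mul_nonneg (Real.rpow_nonneg (lpNorm₀_nonneg _) _) (Real.rpow_nonneg (lpNorm₁_nonneg _) _)

/-- A representable element of norm `< r` has a representation with both norms `< r`. -/
theorem exists_repr_lt {z : A₁} (hz : ∃ x₁ x₂, IsRepr ι θ p z x₁ x₂) {r : ℝ}
    (hr : lionsPeetreNorm ι θ p z < r) :
    ∃ x₁ x₂, IsRepr ι θ p z x₁ x₂ ∧ lpNorm₀ θ p x₁ < r ∧ lpNorm₁ θ p x₂ < r := by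
  obtain ⟨_, ⟨x₁, x₂, h, rfl⟩, hlt⟩ := exists_lt_of_csInf_lt
    (by obtain ⟨x₁, x₂, h⟩ := hz; exact ⟨_, x₁, x₂, h, rfl⟩) hr
  obtain ⟨hθ0, hθ1⟩ := θ.2
  have hθ1' : (0 : ℝ) < 1 - θ := sub_pos.2 hθ1
  have hcont : Tendsto (fun ε : ℝ => (lpNorm₀ θ p x₁ + ε) ^ (1 - θ : ℝ) *
      (lpNorm₁ θ p x₂ + ε) ^ (θ : ℝ)) (𝓝[>] 0)
      (𝓝 (lpNorm₀ θ p x₁ ^ (1 - θ : ℝ) * lpNorm₁ θ p x₂ ^ (θ : ℝ))) := by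
    have : Continuous (fun ε : ℝ => (lpNorm₀ θ p x₁ + ε) ^ (1 - θ : ℝ) *
      (lpNorm₁ θ p x₂ + ε) ^ (θ : ℝ)) :=
      ((continuous_const.add continuous_id).rpow_const fun _ => Or.inr hθ1'.le).mul
        ((continuous_const.add continuous_id).rpow_const fun _ => Or.inr hθ0.le)
    simpa using (this.tendsto 0).mono_left nhdsWithin_le_nhds
  obtain ⟨ε, hε, hε0⟩ := ((hcont.eventually (gt_mem_nhds hlt)).and self_mem_nhdsWithin).exists
  have hε0 : 0 < ε := hε0
  set a := lpNorm₀ θ p x₁ + ε with ha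
  set b := lpNorm₁ θ p x₂ + ε with hb
  have ha0 : 0 < a := add_pos_of_nonneg_of_pos (lpNorm₀_nonneg _) hε0
  have hb0 : 0 < b := add_pos_of_nonneg_of_pos (lpNorm₁_nonneg _) hε0
  obtain ⟨h', h₀, h₁⟩ := h.shift (Real.log a - Real.log b)
  have hval : a ^ (1 - θ : ℝ) * b ^ (θ : ℝ) =
      Real.exp (Real.log a * (1 - θ) + Real.log b * θ) := by
    rw [Real.rpow_def_of_pos ha0, Real.rpow_def_of_pos hb0, Real.exp_add]
  rw [hval] at hε
  refine ⟨_, _, h', ?_, ?_⟩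
  · rw [h₀]
    refine lt_of_le_of_lt ?_ hε
    calc Real.exp (-θ * (Real.log a - Real.log b)) * lpNorm₀ θ p x₁
        ≤ Real.exp (-θ * (Real.log a - Real.log b)) * Real.exp (Real.log a) := by
          rw [Real.exp_log ha0]; gcongr; linarith
      _ = _ := by rw [← Real.exp_add]; congr 1; ring
  · rw [h₁]
    refine lt_of_le_of_lt ?_ hε
    calc Real.exp ((1 - θ) * (Real.log a - Real.log b)) * lpNorm₁ θ p x₂
        ≤ Real.exp ((1 - θ) * (Real.log a - Real.log b)) * Real.exp (Real.log b) := by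
          rw [Real.exp_log hb0]; gcongr; linarith
      _ = _ := by rw [← Real.exp_add]; congr 1; ring

theorem IsRepr.norm_le {z : A₁} {x₁ : ℝ → A₀} {x₂ : ℝ → A₁} (h : IsRepr ι θ p z x₁ x₂) {r : ℝ}
    (h₀ : lpNorm₀ θ p x₁ ≤ r) (h₁ : lpNorm₁ θ p x₂ ≤ r) : lionsPeetreNorm ι θ p z ≤ r := by
  have hr : 0 ≤ r := (lpNorm₀_nonneg _).trans h₀
  obtain ⟨hθ0, hθ1⟩ := θ.2
  have hθ1' : (0 : ℝ) < 1 - θ := sub_pos.2 hθ1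
  have hbdd : BddBelow {r | ∃ x₁ x₂, IsRepr ι θ p z x₁ x₂ ∧
      r = lpNorm₀ θ p x₁ ^ (1 - θ : ℝ) * lpNorm₁ θ p x₂ ^ (θ : ℝ)} := by
    refine ⟨0, ?_⟩
    rintro r ⟨x₁, x₂, -, rfl⟩
    exact mul_nonneg (Real.rpow_nonneg (lpNorm₀_nonneg _) _)
      (Real.rpow_nonneg (lpNorm₁_nonneg _) _)
  refine (csInf_le hbdd ⟨x₁, x₂, h, rfl⟩).trans ?_
  · calc lpNorm₀ θ p x₁ ^ (1 - θ : ℝ) * lpNorm₁ θ p x₂ ^ (θ : ℝ)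
        ≤ r ^ (1 - θ : ℝ) * r ^ (θ : ℝ) :=
          mul_le_mul (Real.rpow_le_rpow (lpNorm₀_nonneg _) h₀ hθ1'.le)
            (Real.rpow_le_rpow (lpNorm₁_nonneg _) h₁ hθ0.le)
            (Real.rpow_nonneg (lpNorm₁_nonneg _) _) (Real.rpow_nonneg hr _)
      _ = r := by rw [← Real.rpow_add_of_nonneg hr hθ1'.le hθ0.le]; simp

/-- The Lions–Peetre norm dominates a multiple of the norm of `A₁`. -/
theorem exists_norm_le (ι : A₀ →L[ℝ] A₁) (θ : Set.Ioo (0 : ℝ) 1) (p : Set.Ioi (1 : ℝ)) :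
    ∃ C : ℝ, 0 ≤ C ∧ ∀ z : A₁, (∃ x₁ x₂, IsRepr ι θ p z x₁ x₂) →
      ‖z‖ ≤ C * lionsPeetreNorm ι θ p z := by
  obtain ⟨hθ0, hθ1⟩ := θ.2
  refine ⟨‖ι‖ + Real.exp 1, by positivity, fun z hz => ?_⟩
  refine le_of_forall_gt_imp_ge_of_dense fun R hR => ?_
  have hC : 0 < ‖ι‖ + Real.exp 1 := by positivity
  obtain ⟨x₁, x₂, h, h₀, h₁⟩ := exists_repr_lt hz (r := R / (‖ι‖ + Real.exp 1))
    (by rw [lt_div_iff₀ hC]; linarith)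
  set r := R / (‖ι‖ + Real.exp 1) with hr
  set μ : Measure ℝ := volume.restrict (Set.Icc 0 1) with hμ
  have hμ1 : μ Set.univ = 1 := by simp [hμ]
  have hμ0 : μ ≠ 0 := fun h => by simp [h] at hμ1
  have hp := one_le_ofReal_exponent p
  have hp0 : ENNReal.ofReal p ≠ 0 := (zero_lt_one.trans_le hp).ne'
  have m₀ := h.memLp₀.restrict (Set.Icc 0 1)
  have m₁ := h.memLp₁.restrict (Set.Icc 0 1)
  have hzc : eLpNorm (fun _ : ℝ => z) (ENNReal.ofReal p) μ = ‖z‖ₑ := by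
    rw [eLpNorm_const _ hp0 hμ0, hμ1]; simp
  have hpt : ∀ᵐ t ∂μ, ‖z‖ ≤ ‖‖ι‖ * ‖Real.exp (θ * t) • x₁ t‖ +
      Real.exp 1 * ‖Real.exp (-(1 - θ) * t) • x₂ t‖‖ := by
    refine (ae_restrict_iff' measurableSet_Icc).2 (Eventually.of_forall fun t ht => ?_)
    rw [Real.norm_of_nonneg (by positivity), ← h.add_eq t, norm_smul, norm_smul,
      Real.norm_of_nonneg (Real.exp_nonneg _), Real.norm_of_nonneg (Real.exp_nonneg _)]
    refine (norm_add_le _ _).trans (add_le_add ?_ ?_)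
    · refine (ι.le_opNorm _).trans ?_
      gcongr
      exact le_mul_of_one_le_left (norm_nonneg _) (Real.one_le_exp (mul_nonneg hθ0.le ht.1))
    · rw [← mul_assoc, ← Real.exp_add]
      exact le_mul_of_one_le_left (norm_nonneg _) (Real.one_le_exp (by nlinarith [ht.1, ht.2]))
  have hle : eLpNorm (fun _ : ℝ => z) (ENNReal.ofReal p) μ ≤
      ENNReal.ofReal ‖ι‖ * ENNReal.ofReal (lpNorm₀ θ p x₁) +
        ENNReal.ofReal (Real.exp 1) * ENNReal.ofReal (lpNorm₁ θ p x₂) := by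
    refine (eLpNorm_mono_ae hpt).trans ?_
    refine (eLpNorm_add_le (f := fun t => ‖ι‖ * ‖Real.exp (θ * t) • x₁ t‖)
      (g := fun t => Real.exp 1 * ‖Real.exp (-(1 - θ) * t) • x₂ t‖)
      (m₀.1.norm.const_mul _) (m₁.1.norm.const_mul _) hp).trans ?_
    refine add_le_add ?_ ?_
    · have := eLpNorm_const_smul (‖ι‖) (fun t => ‖Real.exp (θ * t) • x₁ t‖) (ENNReal.ofReal p) μ
      simp only [Pi.smul_def, smul_eq_mul] at this
      rw [this, eLpNorm_norm, lpNorm₀, ENNReal.ofReal_toReal h.memLp₀.eLpNorm_ne_top,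
        Real.enorm_of_nonneg (norm_nonneg _)]
      gcongr
      exact Measure.restrict_le_self
    · have := eLpNorm_const_smul (Real.exp 1) (fun t => ‖Real.exp (-(1 - θ) * t) • x₂ t‖)
        (ENNReal.ofReal p) μ
      simp only [Pi.smul_def, smul_eq_mul] at this
      rw [this, eLpNorm_norm, lpNorm₁, ENNReal.ofReal_toReal h.memLp₁.eLpNorm_ne_top,
        Real.enorm_of_nonneg (Real.exp_nonneg _)]
      gcongr
      exact Measure.restrict_le_self
  rw [hzc, ← ENNReal.ofReal_mul (norm_nonneg _), ← ENNReal.ofReal_mul (Real.exp_nonneg _),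
    ← ENNReal.ofReal_add (mul_nonneg (norm_nonneg _) (lpNorm₀_nonneg _))
      (mul_nonneg (Real.exp_nonneg _) (lpNorm₁_nonneg _)), ← ofReal_norm,
    ENNReal.ofReal_le_ofReal_iff (add_nonneg (mul_nonneg (norm_nonneg _) (lpNorm₀_nonneg _))
      (mul_nonneg (Real.exp_nonneg _) (lpNorm₁_nonneg _)))] at hle
  calc ‖z‖ ≤ ‖ι‖ * r + Real.exp 1 * r := hle.trans (by gcongr)
    _ = R := by rw [← add_mul, hr, mul_div_cancel₀ _ hC.ne']

variable (ι θ p) in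
/-- The subspace of `A₁` underlying the interpolation space `[A₀, A₁]_{θ, p}`. -/
def lionsPeetreSubmodule : Submodule ℝ A₁ where
  carrier := {z | ∃ x₁ x₂, IsRepr ι θ p z x₁ x₂}
  zero_mem' := ⟨0, 0, .zero⟩
  add_mem' := fun ⟨_, _, h⟩ ⟨_, _, k⟩ => ⟨_, _, h.add k⟩
  smul_mem' := fun c _ ⟨_, _, h⟩ => ⟨_, _, h.smul c⟩

/-- If `U₁` is an isometry of `A₁` that restricts to an isometry `U₀` of `A₀`, a representation
of `z` is mapped to a representation of `U₁ z`. -/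
theorem IsRepr.map {z : A₁} {x₁ : ℝ → A₀} {x₂ : ℝ → A₁}
    (h : IsRepr ι θ p z x₁ x₂) (U₀ : A₀ ≃ₗᵢ[ℝ] A₀) (U₁ : A₁ ≃ₗᵢ[ℝ] A₁)
    (hU : ∀ a, ι (U₀ a) = U₁ (ι a)) :
    IsRepr ι θ p (U₁ z) (U₀ ∘ x₁) (U₁ ∘ x₂) ∧ lpNorm₀ θ p (U₀ ∘ x₁) = lpNorm₀ θ p x₁ ∧
      lpNorm₁ θ p (U₁ ∘ x₂) = lpNorm₁ θ p x₂ := by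
  have e₀ : (fun t => Real.exp (θ * t) • (U₀ ∘ x₁) t) =
      U₀ ∘ fun t => Real.exp (θ * t) • x₁ t := by ext t; simp
  have e₁ : (fun t => Real.exp (-(1 - θ) * t) • (U₁ ∘ x₂) t) =
      U₁ ∘ fun t => Real.exp (-(1 - θ) * t) • x₂ t := by ext t; simp
  refine ⟨⟨?_, ?_, fun t => ?_⟩, ?_, ?_⟩
  · rw [e₀]
    exact h.memLp₀.of_le (U₀.continuous.comp_aestronglyMeasurable h.memLp₀.1)
      (Eventually.of_forall fun t => by simp [norm_smul])
  · rw [e₁]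
    exact h.memLp₁.of_le (U₁.continuous.comp_aestronglyMeasurable h.memLp₁.1)
      (Eventually.of_forall fun t => by simp [norm_smul])
  · rw [Function.comp_apply, Function.comp_apply, hU, ← map_add, h.add_eq]
  · unfold lpNorm₀
    rw [e₀]
    refine congrArg _ (eLpNorm_congr_norm_ae (Eventually.of_forall fun t => ?_))
    rw [Function.comp_apply, U₀.norm_map]
  · unfold lpNorm₁
    rw [e₁]
    refine congrArg _ (eLpNorm_congr_norm_ae (Eventually.of_forall fun t => ?_))
    rw [Function.comp_apply, U₁.norm_map]

theorem lionsPeetreNorm_map_le {z : A₁} (hz : ∃ x₁ x₂, IsRepr ι θ p z x₁ x₂)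
    (U₀ : A₀ ≃ₗᵢ[ℝ] A₀) (U₁ : A₁ ≃ₗᵢ[ℝ] A₁) (hU : ∀ a, ι (U₀ a) = U₁ (ι a)) :
    lionsPeetreNorm ι θ p (U₁ z) ≤ lionsPeetreNorm ι θ p z := by
  refine le_of_forall_gt_imp_ge_of_dense fun R hR => ?_
  obtain ⟨x₁, x₂, h, h₀, h₁⟩ := exists_repr_lt hz hR
  obtain ⟨h', h₀', h₁'⟩ := h.map U₀ U₁ hU
  exact h'.norm_le (h₀'.trans_le h₀.le) (h₁'.trans_le h₁.le)

theorem map_mem {z : A₁} (hz : z ∈ lionsPeetreSubmodule ι θ p) (U₀ : A₀ ≃ₗᵢ[ℝ] A₀)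
    (U₁ : A₁ ≃ₗᵢ[ℝ] A₁) (hU : ∀ a, ι (U₀ a) = U₁ (ι a)) :
    U₁ z ∈ lionsPeetreSubmodule ι θ p := by
  obtain ⟨x₁, x₂, h⟩ := hz
  exact ⟨_, _, (h.map U₀ U₁ hU).1⟩

variable (ι θ p) in
/-- The Lions–Peetre interpolation space `[A₀, A₁]_{θ, p}`, with its norm `lionsPeetreNorm`
(not the norm of `A₁`). -/
def LionsPeetre : Type _ := lionsPeetreSubmodule ι θ p

namespace LionsPeetre

instance : AddCommGroup (LionsPeetre ι θ p) :=
  inferInstanceAs (AddCommGroup (lionsPeetreSubmodule ι θ p))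

instance : Module ℝ (LionsPeetre ι θ p) :=
  inferInstanceAs (Module ℝ (lionsPeetreSubmodule ι θ p))

variable (ι θ p) in
/-- The inclusion of `[A₀, A₁]_{θ, p}` in `A₁`. -/
def incl : LionsPeetre ι θ p →ₗ[ℝ] A₁ := (lionsPeetreSubmodule ι θ p).subtype

theorem incl_injective : Function.Injective (incl ι θ p) := Subtype.val_injective

theorem exists_repr (z : LionsPeetre ι θ p) : ∃ x₁ x₂, IsRepr ι θ p (incl ι θ p z) x₁ x₂ := z.2

instance : Norm (LionsPeetre ι θ p) := ⟨fun z => lionsPeetreNorm ι θ p (incl ι θ p z)⟩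

theorem norm_def (z : LionsPeetre ι θ p) : ‖z‖ = lionsPeetreNorm ι θ p (incl ι θ p z) := rfl

theorem norm_smul_le' (c : ℝ) (z : LionsPeetre ι θ p) : ‖c • z‖ ≤ |c| * ‖z‖ := by
  rcases eq_or_ne c 0 with rfl | hc
  · simp only [zero_smul, abs_zero, zero_mul]
    exact IsRepr.norm_le (ι := ι) (x₁ := 0) (x₂ := 0) .zero
      (by simp [lpNorm₀]) (by simp [lpNorm₁])
  have hc' : 0 < |c| := abs_pos.2 hc
  refine le_of_forall_gt_imp_ge_of_dense fun R hR => ?_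
  obtain ⟨x₁, x₂, h, h₀, h₁⟩ := exists_repr_lt z.exists_repr (r := R / |c|)
    (by rw [lt_div_iff₀ hc', mul_comm]; exact hR)
  rw [lt_div_iff₀ hc', mul_comm] at h₀ h₁
  rw [norm_def, map_smul]
  exact (h.smul c).norm_le (by rw [lpNorm₀_smul]; exact h₀.le) (by rw [lpNorm₁_smul]; exact h₁.le)

theorem normedSpaceCore : NormedSpace.Core ℝ (LionsPeetre ι θ p) where
  norm_nonneg z := lionsPeetreNorm_nonneg _
  norm_smul c z := by
    rw [Real.norm_eq_abs]
    refine le_antisymm (norm_smul_le' c z) ?_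
    rcases eq_or_ne c 0 with rfl | hc
    · rw [abs_zero, zero_mul]; exact lionsPeetreNorm_nonneg _
    have := norm_smul_le' c⁻¹ (c • z)
    rw [smul_smul, inv_mul_cancel₀ hc, one_smul, abs_inv] at this
    rwa [inv_mul_eq_div, le_div_iff₀ (abs_pos.2 hc), mul_comm] at this
  norm_triangle z w := by
    refine le_of_forall_pos_le_add fun ε hε => ?_
    obtain ⟨x₁, x₂, h, h₀, h₁⟩ := exists_repr_lt z.exists_repr (r := ‖z‖ + ε / 2)
      (by rw [norm_def]; linarith)
    obtain ⟨y₁, y₂, k, k₀, k₁⟩ := exists_repr_lt w.exists_repr (r := ‖w‖ + ε / 2)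
      (by rw [norm_def]; linarith)
    rw [norm_def, map_add]
    exact (h.add k).norm_le ((h.lpNorm₀_add_le k).trans (by linarith))
      ((h.lpNorm₁_add_le k).trans (by linarith))
  norm_eq_zero_iff z := by
    constructor
    · intro hz
      obtain ⟨C, -, hC⟩ := exists_norm_le ι θ p
      have := hC _ z.exists_repr
      rw [← norm_def, hz, mul_zero, norm_le_zero_iff] at this
      exact incl_injective (by rw [this, map_zero])
    · rintro rfl
      have := norm_smul_le' (ι := ι) (θ := θ) (p := p) 0 0
      rw [smul_zero, abs_zero, zero_mul] at this
      exact le_antisymm this (lionsPeetreNorm_nonneg _)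

instance : NormedAddCommGroup (LionsPeetre ι θ p) := NormedAddCommGroup.ofCore normedSpaceCore

instance : NormedSpace ℝ (LionsPeetre ι θ p) := NormedSpace.ofCore normedSpaceCore

variable (ι θ p) in
/-- The restriction to `[A₀, A₁]_{θ, p}` of an isometry `U₁` of `A₁` that restricts to an
isometry `U₀` of `A₀`. -/
def mapIso (U₀ : A₀ ≃ₗᵢ[ℝ] A₀) (U₁ : A₁ ≃ₗᵢ[ℝ] A₁) (hU : ∀ a, ι (U₀ a) = U₁ (ι a)) :
    LionsPeetre ι θ p ≃ₗᵢ[ℝ] LionsPeetre ι θ p :=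
  have hU' : ∀ a, ι (U₀.symm a) = U₁.symm (ι a) := fun a => by
    rw [LinearIsometryEquiv.eq_symm_apply, ← hU, U₀.apply_symm_apply]
  { toFun := fun z => ⟨U₁ (incl ι θ p z), map_mem z.2 U₀ U₁ hU⟩
    invFun := fun z => ⟨U₁.symm (incl ι θ p z), map_mem z.2 U₀.symm U₁.symm hU'⟩
    map_add' := fun z w => Subtype.ext (map_add U₁ (incl ι θ p z) (incl ι θ p w))
    map_smul' := fun c z => Subtype.ext (map_smul U₁ c (incl ι θ p z))
    left_inv := fun z => Subtype.ext (U₁.symm_apply_apply _)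
    right_inv := fun z => Subtype.ext (U₁.apply_symm_apply _)
    norm_map' := fun z => by
      refine le_antisymm (lionsPeetreNorm_map_le z.exists_repr U₀ U₁ hU) ?_
      obtain ⟨x₁, x₂, h⟩ := z.exists_repr
      have := lionsPeetreNorm_map_le ⟨_, _, (h.map U₀ U₁ hU).1⟩ U₀.symm U₁.symm hU'
      rw [U₁.symm_apply_apply] at this
      exact this }

@[simp]
theorem incl_mapIso (U₀ : A₀ ≃ₗᵢ[ℝ] A₀) (U₁ : A₁ ≃ₗᵢ[ℝ] A₁) (hU : ∀ a, ι (U₀ a) = U₁ (ι a))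
    (z : LionsPeetre ι θ p) : incl ι θ p (mapIso ι θ p U₀ U₁ hU z) = U₁ (incl ι θ p z) := rfl

end LionsPeetre

end Interpolation

/-! ### The operator `Φ`, the space `R`, and the group of translations -/

section Representation

set_option linter.unusedSectionVars false

variable (X : Type*) [NormedAddCommGroup X] [MeasurableSpace X] [BorelSpace X]

instance isFiniteMeasure_variation (μ : SignedMeasure X) : IsFiniteMeasure μ.variation := by
  rw [← SignedMeasure.totalVariation_eq_variation]
  infer_instance

variable {X}

theorem integrable_kernel (μ : SignedMeasure X) (y : X) :
    μ.Integrable fun x => Real.exp (-‖x - y‖) := by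
  refine Integrable.of_bound (C := 1) ?_ (Eventually.of_forall fun x => ?_)
  · exact (Real.continuous_exp.comp
      (continuous_id.sub continuous_const).norm.neg).measurable.aestronglyMeasurable
  · rw [Real.norm_of_nonneg (Real.exp_nonneg _)]
    exact Real.exp_le_one_iff.2 (by simp)

theorem norm_integral_kernel_le (μ : SignedMeasure X) (y : X) :
    ‖∫ᵛ x, Real.exp (-‖x - y‖) ∂•μ‖ ≤
      μ.variation.real Set.univ := by
  have h := VectorMeasure.norm_integral_le_of_norm_le_const (μ := μ)
    (B := ContinuousLinearMap.lsmul ℝ ℝ) (f := fun x => Real.exp (-‖x - y‖)) (C := 1)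
    (Eventually.of_forall fun x => by
      rw [Real.norm_of_nonneg (Real.exp_nonneg _)]
      exact Real.exp_le_one_iff.2 (by simp))
  refine h.trans ?_
  rw [one_mul]
  exact mul_le_of_le_one_left measureReal_nonneg ContinuousLinearMap.opNorm_lsmul_le

theorem continuous_integral_kernel (μ : SignedMeasure X) :
    Continuous fun y =>
      ∫ᵛ x, Real.exp (-‖x - y‖) ∂•μ := by
  refine VectorMeasure.continuous_of_dominated (bound := fun _ => 1)
    (fun y => (integrable_kernel μ y).1) (fun y => Eventually.of_forall fun x => ?_)
    (integrable_const _) (Eventually.of_forall fun x => ?_)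
  · rw [Real.norm_of_nonneg (Real.exp_nonneg _)]
    exact Real.exp_le_one_iff.2 (by simp)
  · exact Real.continuous_exp.comp (continuous_const.sub continuous_id).norm.neg

variable (X) in
/-- The operator `Φ : M(X) → C_b(X)`, `Φ μ y = ∫ exp (-‖x - y‖) μ(dx)`. Here `M(X)` is the space of
finite signed Borel measures, which are the Radon measures when `X` is separable and complete. -/
def Phi : SignedMeasure X →ₗ[ℝ] (X →ᵇ ℝ) where
  toFun μ := BoundedContinuousFunction.ofNormedAddCommGroup
    (fun y => ∫ᵛ x, Real.exp (-‖x - y‖) ∂•μ)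
    (continuous_integral_kernel μ) (μ.variation.real Set.univ) (norm_integral_kernel_le μ)
  map_add' μ ν := by
    ext y
    exact VectorMeasure.integral_add_vectorMeasure (integrable_kernel μ y) (integrable_kernel ν y)
  map_smul' c μ := by
    ext y
    exact VectorMeasure.integral_smul_vectorMeasure _ c

theorem Phi_apply (μ : SignedMeasure X) (y : X) : Phi X μ y =
    ∫ᵛ x, Real.exp (-‖x - y‖) ∂•μ := rfl

theorem norm_Phi_le (μ : SignedMeasure X) : ‖Phi X μ‖ ≤ μ.variation.real Set.univ :=
  BoundedContinuousFunction.norm_ofNormedAddCommGroup_le _ measureReal_nonneg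
    (norm_integral_kernel_le μ)

variable (X) in
/-- The space `A₀ = Φ(M(X))`, normed by the gauge of the image of the unit ball of `M(X)`
(the quotient norm of `M(X) / ker Φ`, where `M(X)` has the total variation norm). -/
def PhiRange : Type _ := LinearMap.range (Phi X)

namespace PhiRange

instance : AddCommGroup (PhiRange X) := inferInstanceAs (AddCommGroup (LinearMap.range (Phi X)))

instance : Module ℝ (PhiRange X) := inferInstanceAs (Module ℝ (LinearMap.range (Phi X)))

variable (X) in
/-- The inclusion of `A₀` in `C_b(X)`, as a linear map. -/
def inclₗ : PhiRange X →ₗ[ℝ] (X →ᵇ ℝ) := (LinearMap.range (Phi X)).subtype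

theorem inclₗ_injective : Function.Injective (inclₗ X) := Subtype.val_injective

theorem exists_measure (f : PhiRange X) : ∃ μ, Phi X μ = inclₗ X f := f.2

instance : Norm (PhiRange X) :=
  ⟨fun f => sInf {r | ∃ μ : SignedMeasure X, Phi X μ = inclₗ X f ∧
    r = μ.variation.real Set.univ}⟩

theorem norm_le_of_eq {f : PhiRange X} {μ : SignedMeasure X} (h : Phi X μ = inclₗ X f) :
    ‖f‖ ≤ μ.variation.real Set.univ := by
  refine csInf_le ⟨0, ?_⟩ ⟨μ, h, rfl⟩
  rintro r ⟨ν, -, rfl⟩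
  exact measureReal_nonneg

theorem exists_measure_lt {f : PhiRange X} {r : ℝ} (hr : ‖f‖ < r) :
    ∃ μ, Phi X μ = inclₗ X f ∧ μ.variation.real Set.univ < r := by
  obtain ⟨_, ⟨μ, h, rfl⟩, hlt⟩ := exists_lt_of_csInf_lt
    (by obtain ⟨μ, h⟩ := f.exists_measure; exact ⟨_, μ, h, rfl⟩) hr
  exact ⟨μ, h, hlt⟩

theorem norm_nonneg' (f : PhiRange X) : 0 ≤ ‖f‖ := by
  refine Real.sInf_nonneg ?_
  rintro r ⟨ν, -, rfl⟩
  exact measureReal_nonneg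

theorem norm_incl_le' (f : PhiRange X) : ‖inclₗ X f‖ ≤ ‖f‖ := by
  refine le_of_forall_gt_imp_ge_of_dense fun R hR => ?_
  obtain ⟨μ, h, hlt⟩ := exists_measure_lt hR
  rw [← h]
  exact (norm_Phi_le μ).trans hlt.le

theorem norm_smul_le' (c : ℝ) (f : PhiRange X) : ‖c • f‖ ≤ |c| * ‖f‖ := by
  rcases eq_or_ne c 0 with rfl | hc
  · have : ‖(0 : ℝ) • f‖ ≤ (0 : SignedMeasure X).variation.real Set.univ :=
      norm_le_of_eq (by simp)
    simpa using this
  have hc' : 0 < |c| := abs_pos.2 hc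
  refine le_of_forall_gt_imp_ge_of_dense fun R hR => ?_
  obtain ⟨μ, h, hlt⟩ := exists_measure_lt (f := f) (r := R / |c|)
    (by rw [lt_div_iff₀ hc', mul_comm]; exact hR)
  rw [lt_div_iff₀ hc', mul_comm] at hlt
  refine (norm_le_of_eq (μ := c • μ) (by rw [map_smul, map_smul, h])).trans ?_
  rw [VectorMeasure.variation_smul]
  simpa [measureReal_nnreal_smul_apply] using hlt.le

theorem normedSpaceCore : NormedSpace.Core ℝ (PhiRange X) where
  norm_nonneg := norm_nonneg'
  norm_smul c f := by
    rw [Real.norm_eq_abs]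
    refine le_antisymm (norm_smul_le' c f) ?_
    rcases eq_or_ne c 0 with rfl | hc
    · rw [abs_zero, zero_mul]; exact norm_nonneg' _
    have := norm_smul_le' c⁻¹ (c • f)
    rw [smul_smul, inv_mul_cancel₀ hc, one_smul, abs_inv] at this
    rwa [inv_mul_eq_div, le_div_iff₀ (abs_pos.2 hc), mul_comm] at this
  norm_triangle f g := by
    refine le_of_forall_pos_le_add fun ε hε => ?_
    obtain ⟨μ, h, hμ⟩ := exists_measure_lt (f := f) (r := ‖f‖ + ε / 2) (by linarith)
    obtain ⟨ν, k, hν⟩ := exists_measure_lt (f := g) (r := ‖g‖ + ε / 2) (by linarith)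
    refine (norm_le_of_eq (μ := μ + ν) (by rw [map_add, map_add, h, k])).trans ?_
    have h1 : (μ + ν).variation.real Set.univ ≤
        (μ.variation + ν.variation).real Set.univ :=
      ENNReal.toReal_mono (measure_ne_top _ _) (VectorMeasure.variation_add_le Set.univ)
    rw [measureReal_add_apply] at h1
    linarith
  norm_eq_zero_iff f := by
    constructor
    · intro hf
      have := norm_incl_le' f
      rw [hf, norm_le_zero_iff] at this
      exact inclₗ_injective (by rw [this, map_zero])
    · rintro rfl
      have := norm_smul_le' (0 : ℝ) (0 : PhiRange X)
      rw [smul_zero, abs_zero, zero_mul] at this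
      exact le_antisymm this (norm_nonneg' _)

instance : NormedAddCommGroup (PhiRange X) := NormedAddCommGroup.ofCore normedSpaceCore

instance : NormedSpace ℝ (PhiRange X) := NormedSpace.ofCore normedSpaceCore

variable (X) in
/-- The inclusion of `A₀` in `A₁ = C_b(X)`. -/
def incl : PhiRange X →L[ℝ] (X →ᵇ ℝ) :=
  (inclₗ X).mkContinuous 1 fun f => by rw [one_mul]; exact norm_incl_le' f

end PhiRange

/-- The isometry `f ↦ f ∘ g⁻¹` of `C_b(X)` induced by a surjective isometry `g` of `X`. -/
def compIso (g : X ≃ᵢ X) : (X →ᵇ ℝ) ≃ₗᵢ[ℝ] (X →ᵇ ℝ) where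
  toFun f := f.compContinuous ⟨g.symm, g.symm.continuous⟩
  invFun f := f.compContinuous ⟨g, g.continuous⟩
  map_add' _ _ := rfl
  map_smul' _ _ := rfl
  left_inv f := by ext x; simp
  right_inv f := by ext x; simp
  norm_map' f := by
    refine le_antisymm (f.norm_compContinuous_le _) ?_
    have := (f.compContinuous ⟨g.symm, g.symm.continuous⟩).norm_compContinuous_le
      ⟨g, g.continuous⟩
    refine le_trans (le_of_eq (congrArg _ ?_)) this
    ext x; simp

theorem compIso_apply (g : X ≃ᵢ X) (f : X →ᵇ ℝ) (x : X) : compIso g f x = f (g.symm x) := rfl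

/-- `Φ` commutes with the surjective isometries of `X`. -/
theorem compIso_Phi (g : X ≃ᵢ X) (μ : SignedMeasure X) :
    compIso g (Phi X μ) = Phi X (μ.map g) := by
  have hg : MeasurableEmbedding g := g.toHomeomorph.measurableEmbedding
  ext y
  rw [compIso_apply, Phi_apply, Phi_apply, hg.integral_map_vectorMeasure]
  congr 1
  ext x
  have : g x - y = g x - g (g.symm y) := by rw [g.apply_symm_apply]
  rw [this, ← dist_eq_norm, ← dist_eq_norm, g.isometry.dist_eq]

theorem compIso_mem (g : X ≃ᵢ X) {f : X →ᵇ ℝ} (hf : f ∈ LinearMap.range (Phi X)) :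
    compIso g f ∈ LinearMap.range (Phi X) := by
  obtain ⟨μ, rfl⟩ := hf
  exact ⟨μ.map g, (compIso_Phi g μ).symm⟩

/-- The linear map `f ↦ f ∘ g⁻¹` on `A₀`. -/
def PhiRange.compAux (g : X ≃ᵢ X) : PhiRange X →ₗ[ℝ] PhiRange X where
  toFun f := ⟨compIso g (PhiRange.inclₗ X f), compIso_mem g f.2⟩
  map_add' _ _ := rfl
  map_smul' _ _ := rfl

theorem PhiRange.inclₗ_compAux (g : X ≃ᵢ X) (f : PhiRange X) :
    PhiRange.inclₗ X (PhiRange.compAux g f) = compIso g (PhiRange.inclₗ X f) := rfl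

theorem PhiRange.norm_compAux_le (g : X ≃ᵢ X) (f : PhiRange X) : ‖PhiRange.compAux g f‖ ≤ ‖f‖ := by
  refine le_of_forall_gt_imp_ge_of_dense fun R hR => ?_
  obtain ⟨μ, h, hlt⟩ := PhiRange.exists_measure_lt hR
  refine (PhiRange.norm_le_of_eq (μ := μ.map g) ?_).trans (le_trans ?_ hlt.le)
  · rw [PhiRange.inclₗ_compAux, ← h, compIso_Phi]
  · have h1 := ENNReal.toReal_mono (measure_ne_top _ _)
      ((VectorMeasure.variation_map_le (μ := μ) (φ := g)) Set.univ)
    refine h1.trans (le_of_eq ?_)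
    rw [Measure.map_apply g.continuous.measurable MeasurableSet.univ, Set.preimage_univ]
    rfl

theorem PhiRange.compAux_compAux (g h : X ≃ᵢ X) (hgh : ∀ x, h.symm (g.symm x) = x)
    (f : PhiRange X) : PhiRange.compAux g (PhiRange.compAux h f) = f := by
  refine PhiRange.inclₗ_injective ?_
  rw [PhiRange.inclₗ_compAux, PhiRange.inclₗ_compAux]
  ext x
  rw [compIso_apply, compIso_apply, hgh]

/-- The isometry `f ↦ f ∘ g⁻¹` of `A₀` induced by a surjective isometry `g` of `X`. -/
def PhiRange.compIso (g : X ≃ᵢ X) : PhiRange X ≃ₗᵢ[ℝ] PhiRange X where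
  toLinearEquiv := LinearEquiv.ofLinearMap (PhiRange.compAux g) (PhiRange.compAux g.symm)
    (LinearMap.ext fun f => PhiRange.compAux_compAux _ _ (by simp) f)
    (LinearMap.ext fun f => PhiRange.compAux_compAux _ _ (by simp) f)
  norm_map' f := by
    refine le_antisymm (PhiRange.norm_compAux_le g f) ?_
    have := PhiRange.norm_compAux_le g.symm (PhiRange.compAux g f)
    rwa [PhiRange.compAux_compAux _ _ (by simp)] at this

variable (X) in
/-- The space `R = [A₀, A₁]_{θ, p}` of functions on `X`, where `A₀ = Φ(M(X))` and
`A₁ = C_b(X)`. -/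
abbrev RSpace (θ : Set.Ioo (0 : ℝ) 1) (p : Set.Ioi (1 : ℝ)) : Type _ :=
  LionsPeetre (PhiRange.incl X) θ p

variable (θ : Set.Ioo (0 : ℝ) 1) (p : Set.Ioi (1 : ℝ))

/-- The isometry `r ↦ r ∘ g⁻¹` of `R` induced by a surjective isometry `g` of `X`. -/
def RSpace.compIso (g : X ≃ᵢ X) : RSpace X θ p ≃ₗᵢ[ℝ] RSpace X θ p :=
  LionsPeetre.mapIso (PhiRange.incl X) θ p (PhiRange.compIso g) (StableBanach.compIso g)
    fun _ => rfl

theorem RSpace.compIso_apply (g : X ≃ᵢ X) (r : RSpace X θ p) (x : X) :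
    LionsPeetre.incl (PhiRange.incl X) θ p (RSpace.compIso θ p g r) x =
      LionsPeetre.incl (PhiRange.incl X) θ p r (g.symm x) := rfl

/-- The translation `T_z` of `R`, `T_z r x = r (x - z)`. -/
def translation (z : X) : RSpace X θ p ≃ₗᵢ[ℝ] RSpace X θ p :=
  RSpace.compIso θ p (IsometryEquiv.addRight z)

theorem translation_apply (z : X) (r : RSpace X θ p) (x : X) :
    LionsPeetre.incl (PhiRange.incl X) θ p (translation θ p z r) x =
      LionsPeetre.incl (PhiRange.incl X) θ p r (x - z) := by
  rw [translation, RSpace.compIso_apply, IsometryEquiv.addRight_symm, sub_eq_add_neg]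
  rfl

/-- The symmetrization `S` of `R`, `S r x = r (-x)`. -/
def symmetrization : RSpace X θ p ≃ₗᵢ[ℝ] RSpace X θ p :=
  RSpace.compIso θ p (IsometryEquiv.neg X)

theorem symmetrization_apply (r : RSpace X θ p) (x : X) :
    LionsPeetre.incl (PhiRange.incl X) θ p (symmetrization θ p r) x =
      LionsPeetre.incl (PhiRange.incl X) θ p r (-x) := rfl

variable (X) in
/-- The representation `z ↦ T_z` of the additive group of `X` by isometries of `R`. -/
def representation : Multiplicative X →* (RSpace X θ p ≃ₗᵢ[ℝ] RSpace X θ p) where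
  toFun z := translation θ p z.toAdd
  map_one' := by
    ext r : 1
    refine LionsPeetre.incl_injective ?_
    ext x
    rw [translation_apply, toAdd_one, sub_zero]
    rfl
  map_mul' z w := by
    ext r : 1
    refine LionsPeetre.incl_injective ?_
    ext x
    rw [translation_apply, toAdd_mul, ← sub_sub, ← translation_apply, ← translation_apply]
    rfl

variable (X) in
/-- The group `G = {T_z : z ∈ X}` of isometries of `R`. -/
def translationGroup : Subgroup (RSpace X θ p ≃ₗᵢ[ℝ] RSpace X θ p) := (representation X θ p).range

/-- An isometry of `R`, as an element of the space `L(R)` of bounded operators with the weak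
operator topology. -/
def toWOT (U : RSpace X θ p ≃ₗᵢ[ℝ] RSpace X θ p) : RSpace X θ p →WOT[ℝ] RSpace X θ p :=
  ContinuousLinearMapWOT.ofCLM (U : RSpace X θ p →L[ℝ] RSpace X θ p)

variable (X) in
/-- The closure `G̃` of `G` in `L(R)` for the weak operator topology. -/
def closedTranslations : Set (RSpace X θ p →WOT[ℝ] RSpace X θ p) :=
  closure (toWOT θ p '' (translationGroup X θ p : Set (RSpace X θ p ≃ₗᵢ[ℝ] RSpace X θ p)))

end Representation

end StableBanach

end

open Filter Topology MeasureTheory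

open scoped BoundedContinuousFunction ENNReal

noncomputable section

namespace StableBanach

/-! ### The topology of the space of types -/

section TypeTopology

/-- A family of equi-Lipschitz functions that converges at the points of a dense set to a
Lipschitz function converges everywhere. -/
theorem tendsto_of_forall_denseRange {X ι κ : Type*} [SeminormedAddCommGroup X] {d : κ → X}
    (hd : DenseRange d) {l : Filter ι} {F : ι → X → ℝ} {f : X → ℝ} {C : ℝ} (hC : 0 ≤ C)
    (hF : ∀ i z w, |F i z - F i w| ≤ C * ‖z - w‖) (hf : ∀ z w, |f z - f w| ≤ C * ‖z - w‖)
    (h : ∀ k, Tendsto (fun i => F i (d k)) l (𝓝 (f (d k)))) (z : X) :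
    Tendsto (fun i => F i z) l (𝓝 (f z)) := by
  rw [Metric.tendsto_nhds]
  intro ε hε
  obtain ⟨_, ⟨k, rfl⟩, hk⟩ := Metric.mem_closure_iff.1 (hd z) (ε / 3 / (C + 1)) (by positivity)
  filter_upwards [Metric.tendsto_nhds.1 (h k) (ε / 3) (by positivity)] with i hi
  rw [dist_eq_norm, lt_div_iff₀ (by positivity)] at hk
  rw [Real.dist_eq] at hi ⊢
  have h1 := hF i z (d k)
  have h2 := hf z (d k)
  have h3 : C * ‖z - d k‖ < ε / 3 := by nlinarith [norm_nonneg (z - d k)]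
  rw [abs_le] at h1 h2
  rw [abs_lt] at hi ⊢
  constructor <;> linarith

variable {X : Type*} [NormedAddCommGroup X]

theorem TypeSpace.abs_sub_le (τ : TypeSpace X) (z w : X) : |τ.1 z - τ.1 w| ≤ ‖z - w‖ := by
  obtain ⟨x, hx⟩ := τ.2
  exact hx.abs_sub_le z w

theorem TypeSpace.nonneg (τ : TypeSpace X) (z : X) : 0 ≤ τ.1 z := by
  obtain ⟨x, hx⟩ := τ.2
  exact ge_of_tendsto' (hx z) fun n => norm_nonneg _

theorem TypeSpace.le_norm_add (τ : TypeSpace X) (z : X) : τ.1 z ≤ ‖z‖ + τ.1 0 := by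
  have := (abs_le.1 (τ.abs_sub_le z 0)).2
  rw [sub_zero] at this
  linarith

theorem TypeSpace.norm_sub_apply_le (τ : TypeSpace X) (z : X) : ‖z‖ - τ.1 0 ≤ τ.1 z := by
  obtain ⟨x, hx⟩ := τ.2
  refine le_of_tendsto_of_tendsto' ((hx 0).const_sub ‖z‖) (hx z) fun n => ?_
  have := norm_sub_le (z + x n) (x n)
  rw [add_sub_cancel_right] at this
  rw [zero_add]
  linarith

theorem tendsto_typeSpace_iff {ι : Type*} {l : Filter ι} {F : ι → TypeSpace X} {τ : TypeSpace X} :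
    Tendsto F l (𝓝 τ) ↔ ∀ z, Tendsto (fun i => (F i).1 z) l (𝓝 (τ.1 z)) := by
  rw [tendsto_subtype_rng, tendsto_pi_nhds]

theorem tendsto_degenerate_iff {ι : Type*} {l : Filter ι} {x : ι → X} {τ : TypeSpace X} :
    Tendsto (fun i => degenerate (x i)) l (𝓝 τ) ↔
      ∀ z, Tendsto (fun i => ‖z + x i‖) l (𝓝 (τ.1 z)) :=
  tendsto_typeSpace_iff

theorem determines_iff_tendsto {x : ℕ → X} {τ : TypeSpace X} :
    Determines x τ.1 ↔ Tendsto (fun n => degenerate (x n)) atTop (𝓝 τ) :=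
  tendsto_degenerate_iff.symm

theorem isInducing_degenerate : IsInducing (degenerate : X → TypeSpace X) := by
  refine isInducing_iff_nhds.2 fun x => le_antisymm ?_ ?_
  · rw [← map_le_iff_le_comap]
    refine tendsto_degenerate_iff.2 fun z => ?_
    exact (continuous_const.add continuous_id).norm.tendsto x
  · have h := tendsto_degenerate_iff.1 (tendsto_comap (f := degenerate) (x := 𝓝 (degenerate x))) (-x)
    rw [show (degenerate x).1 (-x) = 0 from by simp [degenerate]] at h
    rw [← tendsto_id', tendsto_iff_norm_sub_tendsto_zero]
    refine h.congr fun y => ?_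
    rw [id, neg_add_eq_sub]

theorem denseRange_degenerate : DenseRange (degenerate : X → TypeSpace X) := fun τ => by
  obtain ⟨x, hx⟩ := τ.2
  exact mem_closure_of_tendsto (determines_iff_tendsto.1 hx) (Eventually.of_forall fun n => ⟨_, rfl⟩)

theorem isDenseInducing_degenerate : IsDenseInducing (degenerate : X → TypeSpace X) :=
  ⟨isInducing_degenerate, denseRange_degenerate⟩

theorem isClosed_apply_zero_le (M : ℝ) : IsClosed {τ : TypeSpace X | τ.1 0 ≤ M} :=
  isClosed_le ((continuous_apply 0).comp continuous_subtype_val) continuous_const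

instance [NormedSpace ℝ X] [Nontrivial X] : NoncompactSpace (TypeSpace X) := by
  refine ⟨fun h => ?_⟩
  obtain ⟨C, hC⟩ := (h.image_of_continuousOn (f := fun τ : TypeSpace X => τ.1 0)
    ((continuous_apply 0).comp continuous_subtype_val).continuousOn).bddAbove
  obtain ⟨x, hx⟩ := NormedSpace.exists_lt_norm ℝ X C
  refine hx.not_ge ?_
  have := hC ⟨degenerate x, Set.mem_univ _, rfl⟩
  simpa [degenerate] using this

/-- The embedding of `X` in the compactified space of types. -/
theorem isDenseInducing_coe_degenerate [NormedSpace ℝ X] [Nontrivial X] :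
    IsDenseInducing fun x : X => (degenerate x : CompactTypeSpace X) :=
  ⟨OnePoint.isOpenEmbedding_coe.isInducing.comp isInducing_degenerate,
    OnePoint.denseRange_coe.comp denseRange_degenerate OnePoint.continuous_coe⟩

theorem comap_coe_degenerate_nhds_coe (σ : TypeSpace X) :
    comap (fun x : X => (degenerate x : CompactTypeSpace X)) (𝓝 (σ : CompactTypeSpace X)) =
      comap degenerate (𝓝 σ) := by
  rw [← OnePoint.comap_coe_nhds σ, comap_comap]
  rfl

theorem tendsto_neg_comap_degenerate (σ : TypeSpace X) :
    Tendsto (fun x : X => degenerate (-x)) (comap degenerate (𝓝 σ)) (𝓝 (-σ)) := by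
  refine tendsto_degenerate_iff.2 fun z => ?_
  refine (tendsto_degenerate_iff.1 (tendsto_comap (f := degenerate) (x := 𝓝 σ)) (-z)).congr
    fun x => ?_
  rw [← norm_neg, neg_add, neg_neg]

variable [TopologicalSpace.SeparableSpace X]

theorem isInducing_denseSeq :
    IsInducing fun (τ : TypeSpace X) (k : ℕ) => τ.1 (TopologicalSpace.denseSeq X k) := by
  refine isInducing_iff_nhds.2 fun τ => le_antisymm ?_ ?_
  · rw [← map_le_iff_le_comap]
    refine tendsto_pi_nhds.2 fun k => ?_
    exact tendsto_typeSpace_iff.1 tendsto_id _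
  · rw [← tendsto_id', tendsto_typeSpace_iff]
    refine tendsto_of_forall_denseRange (TopologicalSpace.denseRange_denseSeq X)
      zero_le_one (fun i z w => by rw [one_mul]; exact i.abs_sub_le z w)
      (fun z w => by rw [one_mul]; exact τ.abs_sub_le z w) fun k => ?_
    exact tendsto_pi_nhds.1 (tendsto_comap (f := fun (τ : TypeSpace X) (k : ℕ) =>
      τ.1 (TopologicalSpace.denseSeq X k))) k

instance : FirstCountableTopology (TypeSpace X) := isInducing_denseSeq.firstCountableTopology

theorem isClosed_setOf_determines : IsClosed {f : X → ℝ | ∃ x : ℕ → X, Determines x f} := by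
  refine isClosed_of_closure_subset fun f hf => ?_
  have hlip : ∀ z w, |f z - f w| ≤ ‖z - w‖ := fun z w => by
    have hc : IsClosed {g : X → ℝ | |g z - g w| ≤ ‖z - w‖} :=
      isClosed_le (((continuous_apply z).sub (continuous_apply w)).abs) continuous_const
    refine closure_minimal ?_ hc hf
    rintro g ⟨x, hx⟩
    exact hx.abs_sub_le z w
  let e : (X → ℝ) → ℕ → ℝ := fun g k => g (TopologicalSpace.denseSeq X k)
  have he : Continuous e := continuous_pi fun k => continuous_apply _
  have hcl : e f ∈ closure (Set.range fun x : X => e fun z => ‖z + x‖) := by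
    refine closure_minimal ?_ isClosed_closure (map_mem_closure he hf fun g hg =>
      Set.mem_image_of_mem e hg)
    rintro _ ⟨g, ⟨x, hx⟩, rfl⟩
    refine mem_closure_of_tendsto (f := fun n => e fun z => ‖z + x n‖) (b := atTop)
      (tendsto_pi_nhds.2 fun k => hx _) (Eventually.of_forall fun n => ⟨_, rfl⟩)
  obtain ⟨u, hu, hlim⟩ := mem_closure_iff_seq_limit.1 hcl
  choose x hx using hu
  refine ⟨x, tendsto_of_forall_denseRange (TopologicalSpace.denseRange_denseSeq X)
    zero_le_one (fun n z w => by simpa using abs_norm_sub_norm_le (z + x n) (w + x n))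
    (fun z w => by rw [one_mul]; exact hlip z w) fun k => ?_⟩
  refine (tendsto_pi_nhds.1 hlim k).congr fun n => ?_
  rw [← hx n]

theorem isCompact_apply_zero_le (M : ℝ) : IsCompact {τ : TypeSpace X | τ.1 0 ≤ M} := by
  have hK : IsCompact (Set.univ.pi fun z : X => Set.Icc 0 (‖z‖ + M)) :=
    isCompact_univ_pi fun _ => isCompact_Icc
  refine (isClosed_setOf_determines.isClosedEmbedding_subtypeVal.isCompact_preimage hK).of_isClosed_subset
    (isClosed_apply_zero_le M) fun τ hτ z _ =>
      ⟨TypeSpace.nonneg τ z, (TypeSpace.le_norm_add τ z).trans ?_⟩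
  exact add_le_add_right hτ ‖z‖

theorem tendsto_norm_comap_coclosedCompact :
    Tendsto (fun x : X => ‖x‖) (comap degenerate (coclosedCompact (TypeSpace X))) atTop := by
  refine tendsto_atTop.2 fun M => ?_
  have h : {τ : TypeSpace X | τ.1 0 ≤ M}ᶜ ∈ coclosedCompact (TypeSpace X) :=
    mem_coclosedCompact_iff.2 (by
      rw [compl_compl, (isClosed_apply_zero_le M).closure_eq]
      exact isCompact_apply_zero_le M)
  filter_upwards [preimage_mem_comap h] with x hx
  have : ¬ ‖(0 : X) + x‖ ≤ M := hx
  rw [zero_add] at this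
  exact (not_le.1 this).le

theorem comap_degenerate_coclosedCompact_le :
    comap degenerate (coclosedCompact (TypeSpace X)) ≤ Bornology.cobounded X := by
  rw [← comap_norm_atTop, ← map_le_iff_le_comap]
  exact tendsto_norm_comap_coclosedCompact

theorem exists_ultrafilter_tendsto_degenerate (u : Ultrafilter X) :
    ↑u ≤ Bornology.cobounded X ∨ ∃ τ : TypeSpace X, Tendsto degenerate u (𝓝 τ) := by
  by_cases h : ∃ M : ℝ, ∀ᶠ x in (u : Filter X), ‖x‖ ≤ M
  · obtain ⟨M, hM⟩ := h
    refine Or.inr ?_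
    obtain ⟨τ, -, hτ⟩ := (isCompact_apply_zero_le (X := X) M).ultrafilter_le_nhds
      (u.map degenerate) (le_principal_iff.2 (by
        refine mem_map.2 (hM.mono fun x hx => ?_)
        change ‖0 + x‖ ≤ M
        rwa [zero_add]))
    exact ⟨τ, hτ⟩
  · refine Or.inl ?_
    rw [← comap_norm_atTop, ← map_le_iff_le_comap]
    refine tendsto_atTop.2 fun M => ?_
    by_contra hM
    refine h ⟨M, ?_⟩
    have := Ultrafilter.eventually_not.2 hM
    exact this.mono fun x hx => (not_le.1 hx).le

theorem comap_coe_degenerate_nhds_infty_le :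
    comap (fun x : X => (degenerate x : CompactTypeSpace X)) (𝓝 OnePoint.infty) ≤
      Bornology.cobounded X := by
  refine le_trans (le_of_eq ?_) comap_degenerate_coclosedCompact_le
  rw [← OnePoint.comap_coe_nhds_infty, comap_comap]
  rfl

instance : (Bornology.cobounded X).IsCountablyGenerated := by
  rw [← comap_norm_atTop]
  infer_instance

/-! ### The convolution of types -/

theorem tendsto_conv (hX : IsStable X) (σ τ : TypeSpace X) {x : ℕ → X} (hx : Determines x σ.1)
    (z : X) : Tendsto (fun n => τ.1 (z + x n)) atTop (𝓝 ((conv hX σ τ).1 z)) := by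
  obtain ⟨y, hy⟩ := τ.2
  obtain ⟨L, hL, hlim⟩ := conv_spec hX σ τ x y hx hy z
  refine hlim.congr fun n => ?_
  exact tendsto_nhds_unique (hL n) (hy _)

theorem conv_comm (hX : IsStable X) (σ τ : TypeSpace X) : conv hX σ τ = conv hX τ σ := by
  obtain ⟨x, hx⟩ := σ.2
  obtain ⟨y, hy⟩ := τ.2
  refine Subtype.ext (funext fun z => ?_)
  refine hX (fun n => z + x n) y ⟨_, hx.translate z⟩ ⟨_, hy⟩ _ _ _ _ (fun n => hy _)
    (tendsto_conv hX σ τ hx z) (fun m => ?_) (tendsto_conv hX τ σ hy z)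
  exact (hx (z + y m)).congr fun n => by congr 1; abel

theorem tendsto_comap_degenerate_conv (hX : IsStable X) (σ τ : TypeSpace X) :
    Tendsto τ.1 (comap degenerate (𝓝 σ)) (𝓝 ((conv hX σ τ).1 0)) := by
  refine tendsto_of_seq_tendsto fun x hx => ?_
  simpa [Function.comp_def] using tendsto_conv hX σ τ (determines_iff_tendsto.2 (tendsto_comap_iff.1 hx)) 0

/-- For types `σ`, `τ`, the types `τ (· + x n)` converge to `σ * τ`, if `x` determines `σ`. -/
theorem exists_translate_tendsto_conv (hX : IsStable X) (σ τ : TypeSpace X) {x : ℕ → X}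
    (hx : Determines x σ.1) : ∃ ρ : ℕ → TypeSpace X,
      (∀ n, Tendsto (fun y => degenerate (x n + y)) (comap degenerate (𝓝 τ)) (𝓝 (ρ n))) ∧
        Tendsto ρ atTop (𝓝 (conv hX σ τ)) := by
  obtain ⟨y, hy⟩ := τ.2
  refine ⟨fun n => ⟨fun w => τ.1 (w + x n), _, hy.translate (x n)⟩, fun n => ?_, ?_⟩
  · refine tendsto_degenerate_iff.2 fun z => ?_
    refine (tendsto_degenerate_iff.1 (tendsto_comap (f := degenerate) (x := 𝓝 τ)) (z + x n)).congr
      fun w => ?_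
    rw [add_assoc]
  · exact tendsto_typeSpace_iff.2 fun z => tendsto_conv hX σ τ hx z

end TypeTopology

/-! ### Convex combinations of pointwise convergent families of continuous functions -/

section ConvexCombinations

open scoped CompactlySupported

theorem exists_measure_of_positive {K : Type*} [TopologicalSpace K] [CompactSpace K] [T2Space K]
    [MeasurableSpace K] [BorelSpace K] (φ : C(K, ℝ) →L[ℝ] ℝ) (hφ : ∀ h, 0 ≤ h → 0 ≤ φ h) :
    ∃ μ : Measure K, IsFiniteMeasure μ ∧ ∀ h : C(K, ℝ), ∫ k, h k ∂μ = φ h := by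
  let Λ₀ : C_c(K, ℝ) →ₗ[ℝ] ℝ :=
    { toFun := fun f => φ f.toContinuousMap
      map_add' := fun f g => map_add φ f.toContinuousMap g.toContinuousMap
      map_smul' := fun c f => map_smul φ c f.toContinuousMap }
  let Λ : C_c(K, ℝ) →ₚ[ℝ] ℝ := PositiveLinearMap.mk₀ Λ₀ fun f hf => hφ _ fun k => hf k
  have : IsFiniteMeasureOnCompacts (RealRMK.rieszMeasure Λ) := by
    have := RealRMK.regular_rieszMeasure Λ
    infer_instance
  refine ⟨RealRMK.rieszMeasure Λ, inferInstance, fun h => ?_⟩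
  exact RealRMK.integral_rieszMeasure Λ (CompactlySupportedContinuousMap.continuousMapEquiv h)

/-- If nonnegative, uniformly bounded continuous functions on a compact space converge pointwise to
zero, some of their convex combinations are uniformly small. -/
theorem exists_mem_convexHull_forall_lt {K ι : Type*} [TopologicalSpace K] [CompactSpace K]
    [T2Space K] {l : Filter ι} [l.NeBot] [l.IsCountablyGenerated] {G : ι → C(K, ℝ)} {M : ℝ}
    (hG : ∀ i k, G i k ∈ Set.Icc 0 M) (hlim : ∀ k, Tendsto (fun i => G i k) l (𝓝 0)) {ε : ℝ}
    (hε : 0 < ε) : ∃ g ∈ convexHull ℝ (Set.range G), ∀ k, g k < ε := by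
  by_contra! hcon
  have hU : IsOpen {h : C(K, ℝ) | ∀ k, h k < ε} := by
    have := ContinuousMap.isOpen_setOfPred_mapsTo (isCompact_univ (X := K)) (isOpen_Iio (a := ε))
    simpa [Set.MapsTo] using this
  have hUc : Convex ℝ {h : C(K, ℝ) | ∀ k, h k < ε} := fun h hh g hg a b ha hb hab k =>
    (convex_Iio ε) (hh k) (hg k) ha hb hab
  obtain ⟨φ, u, hφU, hφC⟩ := geometric_hahn_banach_open hUc hU (convex_convexHull ℝ (Set.range G))
    (Set.disjoint_left.2 fun g hg hgC => by
      obtain ⟨k, hk⟩ := hcon g hgC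
      exact (hg k).not_ge hk)
  have hu : 0 < u := by simpa using hφU 0 fun k => hε
  have hpos : ∀ h, 0 ≤ h → 0 ≤ φ h := fun h hh => by
    by_contra! hneg
    have hmem := hφU ((u / φ h) • h) fun k => by
      rw [ContinuousMap.smul_apply, smul_eq_mul]
      have : u / φ h * h k ≤ 0 :=
        mul_nonpos_of_nonpos_of_nonneg (div_nonpos_of_nonneg_of_nonpos hu.le hneg.le) (hh k)
      linarith
    rw [map_smul, smul_eq_mul, div_mul_cancel₀ _ hneg.ne] at hmem
    exact hmem.false
  borelize K
  obtain ⟨μ, hμ, hint⟩ := exists_measure_of_positive φ hpos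
  have hconv : Tendsto (fun i => ∫ k, G i k ∂μ) l (𝓝 (∫ _, (0 : ℝ) ∂μ)) := by
    refine tendsto_integral_filter_of_dominated_convergence (fun _ => M)
      (Eventually.of_forall fun i => (G i).continuous.aestronglyMeasurable)
      (Eventually.of_forall fun i => Eventually.of_forall fun k => ?_) (integrable_const M)
      (Eventually.of_forall hlim)
    rw [Real.norm_of_nonneg (hG i k).1]
    exact (hG i k).2
  rw [integral_zero] at hconv
  refine hu.not_ge (ge_of_tendsto' hconv fun i => ?_)
  rw [hint]
  exact hφC _ (subset_convexHull ℝ _ ⟨i, rfl⟩)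

variable {Y ι : Type*} [TopologicalSpace Y] {l : Filter ι} {g : ι → Y →ᵇ ℝ}
  {f : Y →ᵇ ℝ} {M : ℝ}

theorem mem_closure_convexHull_range [l.NeBot] [l.IsCountablyGenerated] (hg : ∀ i, ‖g i‖ ≤ M)
    (h : ∀ u : Ultrafilter Y, ∃ (F : ι → ℝ) (c : ℝ), (∀ i, Tendsto (g i) u (𝓝 (F i))) ∧
      Tendsto f u (𝓝 c) ∧ Tendsto F l (𝓝 c)) :
    f ∈ closure (convexHull ℝ (Set.range g)) := by
  have hmem : ∀ i y, |g i y - f y| ∈ Set.Icc 0 (M + ‖f‖) := fun i y =>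
    ⟨abs_nonneg _, ((abs_sub _ _).trans
      (add_le_add ((g i).norm_coe_le_norm y) (f.norm_coe_le_norm y))).trans
        (add_le_add (hg i) le_rfl)⟩
  let e : ι → Y → Set.Icc (0 : ℝ) (M + ‖f‖) := fun i y => ⟨|g i y - f y|, hmem i y⟩
  let G : ι → C(Ultrafilter Y, ℝ) := fun i =>
    ⟨fun u => (Ultrafilter.extend (e i) u).1,
      continuous_subtype_val.comp (continuous_ultrafilter_extend (e i))⟩
  have hG : ∀ i u, G i u ∈ Set.Icc 0 (M + ‖f‖) := fun i u => (Ultrafilter.extend (e i) u).2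
  have hGpure : ∀ i y, G i (pure y) = |g i y - f y| := fun i y => by
    change ((Ultrafilter.extend (e i) (pure y) : Set.Icc (0 : ℝ) (M + ‖f‖)) : ℝ) = _
    rw [ultrafilter_extend_pure]
  have hGlim : ∀ u, Tendsto (fun i => G i u) l (𝓝 0) := fun u => by
    obtain ⟨F, c, hF, hc, hFc⟩ := h u
    have hGF : ∀ i, G i u = |F i - c| := fun i => by
      have h1 : Tendsto (e i) u (𝓝 (Ultrafilter.extend (e i) u)) :=
        (ultrafilter_extend_eq_iff (f := e i) (b := u)).1 rfl
      exact tendsto_nhds_unique ((continuous_subtype_val.tendsto _).comp h1) ((hF i).sub hc).abs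
    simp_rw [hGF]
    simpa using (hFc.sub_const c).abs
  rw [Metric.mem_closure_iff]
  intro ε hε
  obtain ⟨H, hH, hHε⟩ := exists_mem_convexHull_forall_lt hG hGlim (half_pos hε)
  have hsub : convexHull ℝ (Set.range G) ⊆
      {H | ∃ k ∈ convexHull ℝ (Set.range g), ∀ y, |k y - f y| ≤ H (pure y)} := by
    refine convexHull_min ?_ ?_
    · rintro _ ⟨i, rfl⟩
      exact ⟨g i, subset_convexHull ℝ _ ⟨i, rfl⟩, fun y => (hGpure i y).ge⟩
    · rintro H₁ ⟨k₁, hk₁, h₁⟩ H₂ ⟨k₂, hk₂, h₂⟩ a b ha hb hab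
      refine ⟨_, convex_convexHull ℝ (Set.range g) hk₁ hk₂ ha hb hab, fun y => ?_⟩
      have : (a • k₁ + b • k₂) y - f y = a * (k₁ y - f y) + b * (k₂ y - f y) := by
        simp only [BoundedContinuousFunction.add_apply, BoundedContinuousFunction.smul_apply,
          smul_eq_mul]
        linear_combination f y * hab
      rw [this]
      refine (abs_add_le _ _).trans ?_
      rw [abs_mul, abs_mul, abs_of_nonneg ha, abs_of_nonneg hb]
      exact add_le_add (mul_le_mul_of_nonneg_left (h₁ y) ha) (mul_le_mul_of_nonneg_left (h₂ y) hb)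
  obtain ⟨k, hk, hkH⟩ := hsub hH
  refine ⟨k, hk, lt_of_le_of_lt ?_ (half_lt_self hε)⟩
  rw [dist_comm, BoundedContinuousFunction.dist_le (half_pos hε).le]
  exact fun y => (hkH y).trans (hHε _).le

/-- A uniformly bounded family of continuous functions that converges along a countably generated
filter at every point of the Stone-Čech compactification has its limit in the closed convex hull of
each frequent subfamily. -/
theorem mem_closure_convexHull_image [l.IsCountablyGenerated] (hg : ∀ i, ‖g i‖ ≤ M)
    (h : ∀ u : Ultrafilter Y, ∃ (F : ι → ℝ) (c : ℝ), (∀ i, Tendsto (g i) u (𝓝 (F i))) ∧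
      Tendsto f u (𝓝 c) ∧ Tendsto F l (𝓝 c)) {S : Set ι} (hS : ∃ᶠ i in l, i ∈ S) :
    f ∈ closure (convexHull ℝ (g '' S)) := by
  have : (comap ((↑) : S → ι) l).NeBot := by
    rw [comap_neBot_iff_frequently]
    simpa using hS
  rw [Set.image_eq_range]
  refine mem_closure_convexHull_range (l := comap ((↑) : S → ι) l) (fun i => hg i) fun u => ?_
  obtain ⟨F, c, hF, hc, hFc⟩ := h u
  exact ⟨fun i => F i, c, fun i => hF i, hc, hFc.comp tendsto_comap⟩

end ConvexCombinations

/-! ### Exponential weights in `L_p` -/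

section Weights

theorem ofReal_exponent_ne_zero (p : Set.Ioi (1 : ℝ)) : ENNReal.ofReal p ≠ 0 :=
  (zero_lt_one.trans_le (one_le_ofReal_exponent p)).ne'

theorem toReal_ofReal_exponent (p : Set.Ioi (1 : ℝ)) : (ENNReal.ofReal p).toReal = p :=
  ENNReal.toReal_ofReal (zero_lt_one.trans p.2).le

variable (p : Set.Ioi (1 : ℝ)) {a : ℝ}

theorem memLp_indicator_exp_Iic (ha : 0 < a) :
    MemLp ((Set.Iic (0 : ℝ)).indicator fun t => Real.exp (a * t)) (ENNReal.ofReal p) volume := by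
  have hp : (0 : ℝ) < p := zero_lt_one.trans p.2
  rw [memLp_indicator_iff_restrict measurableSet_Iic, ← integrable_norm_rpow_iff
    (by fun_prop) (ofReal_exponent_ne_zero p) ENNReal.ofReal_ne_top, toReal_ofReal_exponent]
  refine (integrableOn_exp_mul_Iic (a := a * p) (by positivity) 0).congr
    (Eventually.of_forall fun t => ?_)
  change Real.exp (a * p * t) = ‖Real.exp (a * t)‖ ^ (p : ℝ)
  rw [Real.norm_of_nonneg (Real.exp_nonneg _), ← Real.exp_mul]
  congr 1; ring

theorem memLp_indicator_exp_Ioi (ha : 0 < a) :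
    MemLp ((Set.Ioi (0 : ℝ)).indicator fun t => Real.exp (-a * t)) (ENNReal.ofReal p) volume := by
  have hp : (0 : ℝ) < p := zero_lt_one.trans p.2
  rw [memLp_indicator_iff_restrict measurableSet_Ioi, ← integrable_norm_rpow_iff
    (by fun_prop) (ofReal_exponent_ne_zero p) ENNReal.ofReal_ne_top, toReal_ofReal_exponent]
  refine (integrableOn_exp_mul_Ioi (a := -a * p) (by nlinarith) 0).congr
    (Eventually.of_forall fun t => ?_)
  change Real.exp (-a * p * t) = ‖Real.exp (-a * t)‖ ^ (p : ℝ)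
  rw [Real.norm_of_nonneg (Real.exp_nonneg _), ← Real.exp_mul]
  congr 1; ring

theorem exists_eLpNorm_indicator_exp_Iic (ha : 0 < a) : ∃ C : ℝ, 0 ≤ C ∧ ∀ s : ℝ,
    MemLp ((Set.Iic s).indicator fun t => Real.exp (a * t)) (ENNReal.ofReal p) volume ∧
      (eLpNorm ((Set.Iic s).indicator fun t => Real.exp (a * t)) (ENNReal.ofReal p)
        volume).toReal ≤ C * Real.exp (a * s) := by
  have h := memLp_indicator_exp_Iic p ha
  refine ⟨(eLpNorm ((Set.Iic (0 : ℝ)).indicator fun t => Real.exp (a * t)) (ENNReal.ofReal p)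
    volume).toReal, ENNReal.toReal_nonneg, fun s => ?_⟩
  have hs := measurePreserving_add_right (volume : Measure ℝ) (-s)
  have e : ((Set.Iic s).indicator fun t => Real.exp (a * t)) =
      Real.exp (a * s) • (((Set.Iic (0 : ℝ)).indicator fun t => Real.exp (a * t)) ∘
        fun t => t + -s) := by
    ext t
    simp only [Set.indicator, Set.mem_Iic, Pi.smul_apply, Function.comp_apply, smul_eq_mul,
      mul_ite, mul_zero, ← Real.exp_add]
    refine if_congr (by rw [← sub_eq_add_neg, sub_nonpos]) (by congr 1; ring) rfl
  rw [e]
  refine ⟨(h.comp_measurePreserving hs).const_smul _, ?_⟩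
  rw [eLpNorm_const_smul, eLpNorm_comp_measurePreserving h.1 hs, ENNReal.toReal_mul, mul_comm]
  simp [Real.abs_exp]

theorem exists_eLpNorm_indicator_exp_Ioi (ha : 0 < a) : ∃ C : ℝ, 0 ≤ C ∧ ∀ s : ℝ,
    MemLp ((Set.Ioi s).indicator fun t => Real.exp (-a * t)) (ENNReal.ofReal p) volume ∧
      (eLpNorm ((Set.Ioi s).indicator fun t => Real.exp (-a * t)) (ENNReal.ofReal p)
        volume).toReal ≤ C * Real.exp (-a * s) := by
  have h := memLp_indicator_exp_Ioi p ha
  refine ⟨(eLpNorm ((Set.Ioi (0 : ℝ)).indicator fun t => Real.exp (-a * t)) (ENNReal.ofReal p)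
    volume).toReal, ENNReal.toReal_nonneg, fun s => ?_⟩
  have hs := measurePreserving_add_right (volume : Measure ℝ) (-s)
  have e : ((Set.Ioi s).indicator fun t => Real.exp (-a * t)) =
      Real.exp (-a * s) • (((Set.Ioi (0 : ℝ)).indicator fun t => Real.exp (-a * t)) ∘
        fun t => t + -s) := by
    ext t
    simp only [Set.indicator, Set.mem_Ioi, Pi.smul_apply, Function.comp_apply, smul_eq_mul,
      mul_ite, mul_zero, ← Real.exp_add]
    refine if_congr (by rw [← sub_eq_add_neg, sub_pos]) (by congr 1; ring) rfl
  rw [e]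
  refine ⟨(h.comp_measurePreserving hs).const_smul _, ?_⟩
  rw [eLpNorm_const_smul, eLpNorm_comp_measurePreserving h.1 hs, ENNReal.toReal_mul, mul_comm]
  simp [Real.abs_exp]

variable {p} {E : Type*} [NormedAddCommGroup E]

/-- Comparison of `L_p` norms with a combination of two weights. -/
theorem memLp_and_toReal_eLpNorm_le {F : ℝ → E} {v w : ℝ → ℝ} {b c : ℝ}
    (hF : AEStronglyMeasurable F volume) (hv : MemLp v (ENNReal.ofReal p) volume)
    (hw : MemLp w (ENNReal.ofReal p) volume) (hb : 0 ≤ b) (hc : 0 ≤ c)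
    (h : ∀ t, ‖F t‖ ≤ b * v t + c * w t) :
    MemLp F (ENNReal.ofReal p) volume ∧ (eLpNorm F (ENNReal.ofReal p) volume).toReal ≤
      b * (eLpNorm v (ENNReal.ofReal p) volume).toReal +
        c * (eLpNorm w (ENNReal.ofReal p) volume).toReal := by
  have hv' := hv.const_smul b
  have hw' := hw.const_smul c
  have hle : ∀ t, ‖F t‖ ≤ ‖(b • v + c • w) t‖ := fun t => (h t).trans (Real.le_norm_self _)
  refine ⟨(hv'.add hw').of_le hF (Eventually.of_forall hle), ?_⟩
  have h1 : eLpNorm F (ENNReal.ofReal p) volume ≤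
      eLpNorm (b • v) (ENNReal.ofReal p) volume + eLpNorm (c • w) (ENNReal.ofReal p) volume :=
    (eLpNorm_mono hle).trans (eLpNorm_add_le hv'.1 hw'.1 (one_le_ofReal_exponent p))
  have h2 := ENNReal.toReal_mono
    (ENNReal.add_ne_top.2 ⟨hv'.eLpNorm_ne_top, hw'.eLpNorm_ne_top⟩) h1
  rw [ENNReal.toReal_add hv'.eLpNorm_ne_top hw'.eLpNorm_ne_top, eLpNorm_const_smul,
    eLpNorm_const_smul, ENNReal.toReal_mul, ENNReal.toReal_mul] at h2
  rwa [toReal_enorm, toReal_enorm, Real.norm_of_nonneg hb, Real.norm_of_nonneg hc] at h2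

/-- The tails at `-∞` of a function in `L_p` tend to zero. -/
theorem tendsto_eLpNorm_indicator_Iic {F : ℝ → E} (hF : MemLp F (ENNReal.ofReal p) volume) :
    Tendsto (fun s => eLpNorm ((Set.Iic s).indicator F) (ENNReal.ofReal p) volume) atBot (𝓝 0) := by
  have hp : (0 : ℝ) < p := zero_lt_one.trans p.2
  have hfin : ∫⁻ t, ‖F t‖ₑ ^ (p : ℝ) ∂volume ≠ ∞ := by
    have := (lintegral_rpow_enorm_lt_top_of_eLpNorm_lt_top (ofReal_exponent_ne_zero p)
      ENNReal.ofReal_ne_top hF.2).ne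
    rwa [toReal_ofReal_exponent] at this
  have key : Tendsto (fun s => ∫⁻ t, ‖(Set.Iic s).indicator F t‖ₑ ^ (p : ℝ) ∂volume) atBot
      (𝓝 (∫⁻ _ : ℝ, 0 ∂volume)) := by
    refine tendsto_lintegral_filter_of_dominated_convergence' (fun t => ‖F t‖ₑ ^ (p : ℝ))
      (Eventually.of_forall fun s => ?_) (Eventually.of_forall fun s =>
        Eventually.of_forall fun t => ?_) hfin (Eventually.of_forall fun t => ?_)
    · exact (hF.1.indicator measurableSet_Iic).enorm.pow_const _
    · gcongr
      exact enorm_indicator_le_enorm_self _ _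
    · refine tendsto_const_nhds.congr' ?_
      filter_upwards [eventually_lt_atBot t] with s hs
      rw [Set.indicator_of_notMem (by simpa using hs), enorm_zero, ENNReal.zero_rpow_of_pos hp]
  rw [lintegral_zero] at key
  have := (ENNReal.continuous_rpow_const (y := (1 / p : ℝ))).tendsto 0 |>.comp key
  rw [ENNReal.zero_rpow_of_pos (by positivity)] at this
  refine this.congr fun s => ?_
  rw [eLpNorm_eq_lintegral_rpow_enorm_toReal (ofReal_exponent_ne_zero p) ENNReal.ofReal_ne_top,
    toReal_ofReal_exponent]
  rfl

end Weights

/-! ### Bounded subsets of `A₀` in the interpolation space -/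

section BoundedSubsets

variable {A₀ A₁ : Type*} [NormedAddCommGroup A₀] [NormedSpace ℝ A₀]
  [NormedAddCommGroup A₁] [NormedSpace ℝ A₁] {ι : A₀ →L[ℝ] A₁} {θ : Set.Ioo (0 : ℝ) 1}
  {p : Set.Ioi (1 : ℝ)}

variable (ι θ p) in
/-- An element of `A₁` in the closure of the ball of radius `M` of `A₀` has representations with
explicitly bounded norms. -/
theorem exists_isRepr_of_mem_closure : ∃ C : ℝ, 0 ≤ C ∧ ∀ (M : ℝ) (f : A₁) (s η : ℝ), 0 ≤ M →
    f ∈ closure (ι '' Metric.closedBall 0 M) → 0 < η → ∃ x₁ x₂, IsRepr ι θ p f x₁ x₂ ∧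
      lpNorm₀ θ p x₁ ≤ C * Real.exp (θ * s) * M ∧
      lpNorm₁ θ p x₂ ≤ η + C * Real.exp (-(1 - θ) * s) * ‖f‖ := by
  obtain ⟨hθ0, hθ1⟩ := θ.2
  have hθ1' : (0 : ℝ) < 1 - θ := sub_pos.2 hθ1
  obtain ⟨C₀, hC₀, h₀⟩ := exists_eLpNorm_indicator_exp_Iic p hθ0
  obtain ⟨C₁, hC₁, h₁⟩ := exists_eLpNorm_indicator_exp_Ioi p hθ1'
  obtain ⟨C₂, hC₂, h₂⟩ := exists_eLpNorm_indicator_exp_Iic p one_pos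
  refine ⟨max C₀ C₁, le_max_of_le_left hC₀, fun M f s η hM hf hη => ?_⟩
  set η' := η / (C₂ * Real.exp (1 * s) + 1) with hη'
  have hden : 0 < C₂ * Real.exp (1 * s) + 1 := by positivity
  have hη'0 : 0 < η' := div_pos hη hden
  have hc : ∀ k : ℕ, ∃ c : A₀, ‖c‖ ≤ M ∧ ‖f - ι c‖ ≤ η' * Real.exp ((2 - θ) * (s - k - 1)) := by
    intro k
    obtain ⟨_, ⟨c, hc, rfl⟩, hcf⟩ := Metric.mem_closure_iff.1 hf
      (η' * Real.exp ((2 - θ) * (s - k - 1))) (by positivity)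
    rw [dist_eq_norm] at hcf
    exact ⟨c, by simpa using hc, hcf.le⟩
  choose c hcM hcf using hc
  set x₁ : ℝ → A₀ := (Set.Iic s).indicator fun t => c ⌊s - t⌋₊ with hx₁
  have hx₁m : StronglyMeasurable x₁ := by
    refine StronglyMeasurable.indicator ?_ measurableSet_Iic
    exact (StronglyMeasurable.of_discrete (f := c)).comp_measurable
      (Nat.measurable_floor.comp (measurable_const.sub measurable_id))
  have hx₂m : StronglyMeasurable fun t => f - ι (x₁ t) :=
    stronglyMeasurable_const.sub (ι.continuous.comp_stronglyMeasurable hx₁m)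
  have hb₀ : ∀ t, ‖Real.exp (θ * t) • x₁ t‖ ≤
      M * (Set.Iic s).indicator (fun t => Real.exp (θ * t)) t +
        0 * (Set.Iic s).indicator (fun t => Real.exp (θ * t)) t := fun t => by
    by_cases ht : t ∈ Set.Iic s
    · rw [hx₁, Set.indicator_of_mem ht, Set.indicator_of_mem ht, norm_smul,
        Real.norm_of_nonneg (Real.exp_nonneg _), zero_mul, add_zero, mul_comm]
      exact mul_le_mul_of_nonneg_right (hcM _) (Real.exp_nonneg _)
    · rw [hx₁, Set.indicator_of_notMem ht, Set.indicator_of_notMem ht]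
      simp
  have hb₁ : ∀ t, ‖Real.exp (-(1 - θ) * t) • (f - ι (x₁ t))‖ ≤
      η' * (Set.Iic s).indicator (fun t => Real.exp (1 * t)) t +
        ‖f‖ * (Set.Ioi s).indicator (fun t => Real.exp (-(1 - θ) * t)) t := fun t => by
    rw [norm_smul, Real.norm_of_nonneg (Real.exp_nonneg _)]
    by_cases ht : t ∈ Set.Iic s
    · have ht' : t ∉ Set.Ioi s := by simpa using ht
      rw [hx₁, Set.indicator_of_mem ht, Set.indicator_of_mem ht, Set.indicator_of_notMem ht',
        mul_zero, add_zero]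
      have hk : s - ⌊s - t⌋₊ - 1 ≤ t := by
        have := Nat.lt_floor_add_one (s - t)
        linarith
      calc Real.exp (-(1 - θ) * t) * ‖f - ι (c ⌊s - t⌋₊)‖
          ≤ Real.exp (-(1 - θ) * t) * (η' * Real.exp ((2 - θ) * (s - ⌊s - t⌋₊ - 1))) := by
            gcongr; exact hcf _
        _ ≤ Real.exp (-(1 - θ) * t) * (η' * Real.exp ((2 - θ) * t)) := by
            have : (0 : ℝ) ≤ 2 - θ := by linarith
            gcongr
        _ = η' * Real.exp (1 * t) := by
            rw [mul_left_comm, ← Real.exp_add]; congr 2; ring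
    · have ht' : t ∈ Set.Ioi s := by simpa using ht
      rw [hx₁, Set.indicator_of_notMem ht, Set.indicator_of_notMem ht, Set.indicator_of_mem ht',
        map_zero, sub_zero, mul_zero, zero_add, mul_comm]
  obtain ⟨m₀, n₀⟩ := memLp_and_toReal_eLpNorm_le (p := p)
    ((by fun_prop : Continuous fun t : ℝ => Real.exp (θ * t)).aestronglyMeasurable.smul
      hx₁m.aestronglyMeasurable) (h₀ s).1 (h₀ s).1 hM le_rfl hb₀
  obtain ⟨m₁, n₁⟩ := memLp_and_toReal_eLpNorm_le (p := p)
    ((by fun_prop : Continuous fun t : ℝ => Real.exp (-(1 - θ) * t)).aestronglyMeasurable.smul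
      hx₂m.aestronglyMeasurable) (h₂ s).1 (h₁ s).1 hη'0.le (norm_nonneg f) hb₁
  refine ⟨x₁, fun t => f - ι (x₁ t), ⟨m₀, m₁, fun t => by abel⟩, n₀.trans ?_, n₁.trans ?_⟩
  · rw [zero_mul, add_zero, mul_comm]
    refine mul_le_mul_of_nonneg_right ((h₀ s).2.trans ?_) hM
    gcongr
    exact le_max_left _ _
  · refine add_le_add ?_ ?_
    · calc η' * _ ≤ η' * (C₂ * Real.exp (1 * s)) := by gcongr; exact (h₂ s).2
        _ ≤ η' * (C₂ * Real.exp (1 * s) + 1) := by gcongr; linarith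
        _ = η := div_mul_cancel₀ _ hden.ne'
    · rw [mul_comm]
      refine mul_le_mul_of_nonneg_right ((h₁ s).2.trans ?_) (norm_nonneg f)
      gcongr
      exact le_max_right _ _

theorem mem_lionsPeetreSubmodule_of_mem_closure {M : ℝ} (hM : 0 ≤ M) {f : A₁}
    (hf : f ∈ closure (ι '' Metric.closedBall 0 M)) : f ∈ lionsPeetreSubmodule ι θ p := by
  obtain ⟨C, -, h⟩ := exists_isRepr_of_mem_closure ι θ p
  obtain ⟨x₁, x₂, hr, -⟩ := h M f 0 1 hM hf one_pos
  exact ⟨x₁, x₂, hr⟩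

variable (ι θ p) in
/-- On bounded subsets of `A₀`, the Lions–Peetre norm is small if the norm of `A₁` is small. -/
theorem exists_lionsPeetreNorm_le_of_norm_le {M : ℝ} (hM : 0 ≤ M) {ε : ℝ} (hε : 0 < ε) :
    ∃ δ > 0, ∀ f ∈ closure (ι '' Metric.closedBall 0 M), ‖f‖ ≤ δ →
      lionsPeetreNorm ι θ p f ≤ ε := by
  obtain ⟨C, hC, h⟩ := exists_isRepr_of_mem_closure ι θ p
  have hlim : Tendsto (fun s : ℝ => C * Real.exp (θ * s) * M) atBot (𝓝 0) := by
    have h1 : Tendsto (fun s : ℝ => Real.exp (θ * s)) atBot (𝓝 0) :=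
      Real.tendsto_exp_atBot.comp (tendsto_id.const_mul_atBot θ.2.1)
    simpa using (h1.const_mul C).mul_const M
  obtain ⟨s, hs⟩ := (hlim.eventually (ge_mem_nhds hε)).exists
  have hD : 0 < C * Real.exp (-(1 - θ) * s) + 1 := by positivity
  refine ⟨ε / 2 / (C * Real.exp (-(1 - θ) * s) + 1), by positivity, fun f hf hfδ => ?_⟩
  obtain ⟨x₁, x₂, hr, h₀, h₁⟩ := h M f s (ε / 2) hM hf (half_pos hε)
  refine hr.norm_le (h₀.trans hs) (h₁.trans ?_)
  rw [le_div_iff₀ hD] at hfδ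
  nlinarith [norm_nonneg f]

namespace LionsPeetre

variable (ι θ p) in
/-- The inclusion of `A₀` in `[A₀, A₁]_{θ, p}`. -/
def ofA₀ : A₀ →ₗ[ℝ] LionsPeetre ι θ p :=
  LinearMap.codRestrict (lionsPeetreSubmodule ι θ p) (ι : A₀ →ₗ[ℝ] A₁) fun a =>
    mem_lionsPeetreSubmodule_of_mem_closure (norm_nonneg a)
      (subset_closure ⟨a, by simp, rfl⟩)

theorem incl_ofA₀ (a : A₀) : incl ι θ p (ofA₀ ι θ p a) = ι a := rfl

/-- The element of `[A₀, A₁]_{θ, p}` given by an element of `A₁` in the closure of a ball of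
`A₀`. -/
def ofMemClosure {M : ℝ} (hM : 0 ≤ M) {f : A₁} (hf : f ∈ closure (ι '' Metric.closedBall 0 M)) :
    LionsPeetre ι θ p :=
  ⟨f, mem_lionsPeetreSubmodule_of_mem_closure hM hf⟩

variable (ι θ p) in
theorem exists_norm_le_of_norm_incl_le {M : ℝ} (hM : 0 ≤ M) {ε : ℝ} (hε : 0 < ε) :
    ∃ δ > 0, ∀ z : LionsPeetre ι θ p, incl ι θ p z ∈ closure (ι '' Metric.closedBall 0 M) →
      ‖incl ι θ p z‖ ≤ δ → ‖z‖ ≤ ε := by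
  obtain ⟨δ, hδ, h⟩ := exists_lionsPeetreNorm_le_of_norm_le ι θ p hM hε
  exact ⟨δ, hδ, fun z hz hzδ => h _ hz hzδ⟩

variable (ι θ p) in
/-- The inclusion of `[A₀, A₁]_{θ, p}` in `A₁` as a continuous linear map. -/
def inclL : LionsPeetre ι θ p →L[ℝ] A₁ :=
  LinearMap.mkContinuous (incl ι θ p) (exists_norm_le ι θ p).choose fun z =>
    (exists_norm_le ι θ p).choose_spec.2 _ z.exists_repr

/-- A bounded family in `A₀` that converges weakly in `A₁` (in the sense that the limit is in the
closed convex hull of each frequent subfamily) converges weakly in `[A₀, A₁]_{θ, p}`. -/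
theorem tendsto_dual_ofA₀ {κ : Type*} {l : Filter κ} {g : κ → A₀} {M : ℝ}
    (hg : ∀ i, ‖g i‖ ≤ M) {z : LionsPeetre ι θ p}
    (h : ∀ S : Set κ, (∃ᶠ i in l, i ∈ S) →
      incl ι θ p z ∈ closure (convexHull ℝ ((fun i => ι (g i)) '' S)))
    (φ : LionsPeetre ι θ p →L[ℝ] ℝ) :
    Tendsto (fun i => φ (ofA₀ ι θ p (g i))) l (𝓝 (φ z)) := by
  suffices key : ∀ φ : LionsPeetre ι θ p →L[ℝ] ℝ, ∀ ε > 0,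
      ∀ᶠ i in l, φ (ofA₀ ι θ p (g i)) < φ z + ε by
    rw [Metric.tendsto_nhds]
    intro ε hε
    filter_upwards [key φ ε hε, key (-φ) ε hε] with i h1 h2
    rw [neg_apply, neg_apply] at h2
    rw [Real.dist_eq, abs_lt]
    constructor <;> linarith
  intro φ ε hε
  by_contra hcon
  set S : Set κ := {i | φ z + ε ≤ φ (ofA₀ ι θ p (g i))} with hS
  have hfreq : ∃ᶠ i in l, i ∈ S := by
    simpa only [hS, Set.mem_ofPred_eq, not_lt] using not_eventually.1 hcon
  have hz := h S hfreq
  have himg : convexHull ℝ ((fun i => ι (g i)) '' S) = ι '' convexHull ℝ (g '' S) := by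
    rw [← Set.image_image ι g S]
    exact ((ι : A₀ →ₗ[ℝ] A₁).image_convexHull _).symm
  rw [himg] at hz
  have hM : 0 ≤ M := by
    obtain ⟨i, -⟩ := hfreq.exists
    exact (norm_nonneg _).trans (hg i)
  have hball : convexHull ℝ (g '' S) ⊆ Metric.closedBall 0 M := by
    refine convexHull_min ?_ (convex_closedBall 0 M)
    rintro _ ⟨i, -, rfl⟩
    simpa using hg i
  have hhalf : convexHull ℝ (g '' S) ⊆ {a | φ z + ε ≤ φ (ofA₀ ι θ p a)} := by
    refine convexHull_min ?_ ?_
    · rintro _ ⟨i, hi, rfl⟩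
      exact hi
    · exact convex_halfSpace_ge
        (f := fun a => φ (ofA₀ ι θ p a)) (LinearMap.isLinear (φ.toLinearMap ∘ₗ ofA₀ ι θ p)) _
  obtain ⟨δ, hδ, hsmall⟩ := exists_norm_le_of_norm_incl_le ι θ p (M := M + M) (by positivity)
    (ε := ε / 2 / (‖φ‖ + 1)) (by positivity)
  obtain ⟨_, ⟨c, hc, rfl⟩, hcz⟩ := Metric.mem_closure_iff.1 hz δ hδ
  rw [dist_eq_norm] at hcz
  have hdiff : ‖z - ofA₀ ι θ p c‖ ≤ ε / 2 / (‖φ‖ + 1) := by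
    refine hsmall _ ?_ (by rw [map_sub, incl_ofA₀]; exact hcz.le)
    rw [map_sub, incl_ofA₀]
    have hmaps : Set.MapsTo (fun y => y - ι c) (ι '' convexHull ℝ (g '' S))
        (ι '' Metric.closedBall 0 (M + M)) := by
      rintro _ ⟨a, ha, rfl⟩
      refine ⟨a - c, ?_, map_sub ι a c⟩
      rw [mem_closedBall_zero_iff]
      exact (norm_sub_le _ _).trans (add_le_add (by simpa using hball ha) (by simpa using hball hc))
    exact map_mem_closure (f := fun y => y - ι c) (continuous_id.sub continuous_const) hz hmaps
  have h1 : φ z + ε ≤ φ (ofA₀ ι θ p c) := hhalf hc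
  have h2 : ‖φ (z - ofA₀ ι θ p c)‖ ≤ ‖φ‖ * (ε / 2 / (‖φ‖ + 1)) :=
    (φ.le_opNorm _).trans (mul_le_mul_of_nonneg_left hdiff (norm_nonneg _))
  have h3 : ‖φ‖ * (ε / 2 / (‖φ‖ + 1)) ≤ ε / 2 := by
    rw [mul_div_assoc', div_le_iff₀ (by positivity)]
    nlinarith [norm_nonneg φ]
  rw [map_sub, Real.norm_eq_abs] at h2
  have := (abs_le.1 (h2.trans h3)).1
  linarith

variable (ι θ p) in
/-- `A₀` is dense in `[A₀, A₁]_{θ, p}`. -/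
theorem denseRange_ofA₀ : DenseRange (ofA₀ ι θ p) := by
  obtain ⟨hθ0, hθ1⟩ := θ.2
  have hθ1' : (0 : ℝ) < 1 - θ := sub_pos.2 hθ1
  obtain ⟨C₀, hC₀, h₀⟩ := exists_eLpNorm_indicator_exp_Iic p hθ0
  obtain ⟨C₁, hC₁, h₁⟩ := exists_eLpNorm_indicator_exp_Ioi p hθ1'
  intro z
  rw [Metric.mem_closure_range_iff]
  intro ε hε
  obtain ⟨x₁, x₂, h⟩ := z.exists_repr
  set η := ε / 2 / (1 + C₀ + C₁) with hη
  have hη0 : 0 < η := by positivity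
  have hη1 : (1 + C₀ + C₁) * η = ε / 2 := mul_div_cancel₀ _ (by positivity)
  have t₀ := (tendsto_eLpNorm_indicator_Iic h.memLp₀).eventually
    (ge_mem_nhds (ENNReal.ofReal_pos.2 hη0))
  have t₁ := (tendsto_eLpNorm_indicator_Iic h.memLp₁).eventually
    (ge_mem_nhds (ENNReal.ofReal_pos.2 hη0))
  obtain ⟨s₀, hs₀⟩ := eventually_atBot.1 (t₀.and t₁)
  obtain ⟨s, hss, hu, hv⟩ : ∃ s ≤ s₀, ‖Real.exp (θ * s) • x₁ s‖ ≤ η ∧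
      ‖Real.exp (-(1 - θ) * s) • x₂ s‖ ≤ η := by
    by_contra! hcon
    have hsub : Set.Iic s₀ ⊆ {t | η ≤ ‖Real.exp (θ * t) • x₁ t‖} ∪
        {t | η ≤ ‖Real.exp (-(1 - θ) * t) • x₂ t‖} := fun t ht => by
      by_cases hut : ‖Real.exp (θ * t) • x₁ t‖ ≤ η
      · exact Or.inr (hcon t ht hut).le
      · exact Or.inl (not_le.1 hut).le
    have f₀ := h.memLp₀.meas_ge_lt_top'_enorm (ofReal_exponent_ne_zero p) ENNReal.ofReal_ne_top
      (ε := ENNReal.ofReal η) (ENNReal.ofReal_pos.2 hη0).ne' (by simp)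
    have f₁ := h.memLp₁.meas_ge_lt_top'_enorm (ofReal_exponent_ne_zero p) ENNReal.ofReal_ne_top
      (ε := ENNReal.ofReal η) (ENNReal.ofReal_pos.2 hη0).ne' (by simp)
    have hle := (measure_mono hsub).trans (measure_union_le (μ := volume) _ _)
    rw [Real.volume_Iic, top_le_iff, ENNReal.add_eq_top] at hle
    simp only [← ofReal_norm, ENNReal.ofReal_le_ofReal_iff (norm_nonneg _)] at f₀ f₁
    rcases hle with hle | hle
    · exact f₀.ne hle
    · exact f₁.ne hle
  obtain ⟨hs₀', hs₁'⟩ := hs₀ s hss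
  rw [norm_smul, Real.norm_of_nonneg (Real.exp_nonneg _)] at hu hv
  refine ⟨x₁ s, ?_⟩
  set u : ℝ → A₀ := (Set.Iic s).indicator fun t => Real.exp (θ * t) • x₁ t with hu_def
  set v : ℝ → A₁ := (Set.Iic s).indicator fun t => Real.exp (-(1 - θ) * t) • x₂ t with hv_def
  have hum : MemLp u (ENNReal.ofReal p) volume := h.memLp₀.indicator measurableSet_Iic
  have hvm : MemLp v (ENNReal.ofReal p) volume := h.memLp₁.indicator measurableSet_Iic
  set y₁ : ℝ → A₀ := (Set.Iic s).indicator fun t => x₁ t - x₁ s with hy₁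
  set y₂ : ℝ → A₁ := fun t => if t ≤ s then x₂ t else x₂ s with hy₂
  have e₀ : (fun t => Real.exp (θ * t) • y₁ t) =
      u - (Set.Iic s).indicator fun t => Real.exp (θ * t) • x₁ s := by
    ext t
    by_cases ht : t ∈ Set.Iic s <;> simp [hy₁, hu_def, ht, smul_sub]
  have e₁ : (fun t => Real.exp (-(1 - θ) * t) • y₂ t) =
      v + (Set.Ioi s).indicator fun t => Real.exp (-(1 - θ) * t) • x₂ s := by
    ext t
    by_cases ht : t ≤ s
    · simp [hy₂, hv_def, ht]
    · simp [hy₂, hv_def, ht, not_le.1 ht]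
  have m₀ : AEStronglyMeasurable (fun t => Real.exp (θ * t) • y₁ t) volume := by
    rw [e₀]
    exact hum.1.sub ((by fun_prop : Continuous fun t : ℝ =>
      Real.exp (θ * t) • x₁ s).aestronglyMeasurable.indicator measurableSet_Iic)
  have m₁ : AEStronglyMeasurable (fun t => Real.exp (-(1 - θ) * t) • y₂ t) volume := by
    rw [e₁]
    exact hvm.1.add ((by fun_prop : Continuous fun t : ℝ =>
      Real.exp (-(1 - θ) * t) • x₂ s).aestronglyMeasurable.indicator measurableSet_Ioi)
  have b₀ : ∀ t, ‖Real.exp (θ * t) • y₁ t‖ ≤ 1 * ‖u t‖ +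
      ‖x₁ s‖ * (Set.Iic s).indicator (fun t => Real.exp (θ * t)) t := fun t => by
    rw [congrFun e₀ t, Pi.sub_apply, one_mul]
    refine (norm_sub_le _ _).trans (add_le_add le_rfl ?_)
    by_cases ht : t ∈ Set.Iic s
    · rw [Set.indicator_of_mem ht, Set.indicator_of_mem ht, norm_smul,
        Real.norm_of_nonneg (Real.exp_nonneg _), mul_comm]
    · rw [Set.indicator_of_notMem ht, Set.indicator_of_notMem ht, norm_zero, mul_zero]
  have b₁ : ∀ t, ‖Real.exp (-(1 - θ) * t) • y₂ t‖ ≤ 1 * ‖v t‖ +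
      ‖x₂ s‖ * (Set.Ioi s).indicator (fun t => Real.exp (-(1 - θ) * t)) t := fun t => by
    rw [congrFun e₁ t, Pi.add_apply, one_mul]
    refine (norm_add_le _ _).trans (add_le_add le_rfl ?_)
    by_cases ht : t ∈ Set.Ioi s
    · rw [Set.indicator_of_mem ht, Set.indicator_of_mem ht, norm_smul,
        Real.norm_of_nonneg (Real.exp_nonneg _), mul_comm]
    · rw [Set.indicator_of_notMem ht, Set.indicator_of_notMem ht, norm_zero, mul_zero]
  obtain ⟨M₀, n₀⟩ := memLp_and_toReal_eLpNorm_le (p := p) m₀ hum.norm (h₀ s).1 zero_le_one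
    (norm_nonneg _) b₀
  obtain ⟨M₁, n₁⟩ := memLp_and_toReal_eLpNorm_le (p := p) m₁ hvm.norm (h₁ s).1 zero_le_one
    (norm_nonneg _) b₁
  have hr : IsRepr ι θ p (incl ι θ p (z - ofA₀ ι θ p (x₁ s))) y₁ y₂ := by
    refine ⟨M₀, M₁, fun t => ?_⟩
    rw [map_sub, incl_ofA₀]
    by_cases ht : t ≤ s
    · rw [← h.add_eq t]
      simp only [hy₁, hy₂, Set.indicator_of_mem (Set.mem_Iic.2 ht), if_pos ht, map_sub]
      abel
    · rw [← h.add_eq s]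
      simp only [hy₁, hy₂, Set.indicator_of_notMem (mt Set.mem_Iic.1 ht), if_neg ht, map_zero]
      abel
  rw [eLpNorm_norm, one_mul] at n₀ n₁
  have k₀ : (eLpNorm u (ENNReal.ofReal p) volume).toReal ≤ η :=
    ENNReal.toReal_le_of_le_ofReal hη0.le hs₀'
  have k₁ : (eLpNorm v (ENNReal.ofReal p) volume).toReal ≤ η :=
    ENNReal.toReal_le_of_le_ofReal hη0.le hs₁'
  rw [dist_eq_norm]
  refine lt_of_le_of_lt (hr.norm_le (r := ε / 2) (n₀.trans ?_) (n₁.trans ?_)) (half_lt_self hε)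
  · calc _ ≤ η + ‖x₁ s‖ * (C₀ * Real.exp (θ * s)) := by gcongr; exact (h₀ s).2
      _ = η + C₀ * (Real.exp (θ * s) * ‖x₁ s‖) := by ring
      _ ≤ η + C₀ * η := by gcongr
      _ ≤ (1 + C₀ + C₁) * η := by nlinarith
      _ = ε / 2 := hη1
  · calc _ ≤ η + ‖x₂ s‖ * (C₁ * Real.exp (-(1 - θ) * s)) := by gcongr; exact (h₁ s).2
      _ = η + C₁ * (Real.exp (-(1 - θ) * s) * ‖x₂ s‖) := by ring
      _ ≤ η + C₁ * η := by gcongr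
      _ ≤ (1 + C₀ + C₁) * η := by nlinarith
      _ = ε / 2 := hη1

end LionsPeetre

end BoundedSubsets

/-! ### Completeness of the interpolation space -/

section Completeness

variable {A₀ A₁ : Type*} [NormedAddCommGroup A₀] [NormedSpace ℝ A₀]
  [NormedAddCommGroup A₁] [NormedSpace ℝ A₁] {ι : A₀ →L[ℝ] A₁} {θ : Set.Ioo (0 : ℝ) 1}
  {p : Set.Ioi (1 : ℝ)}

theorem IsRepr.sub {z w : A₁} {x₁ y₁ : ℝ → A₀} {x₂ y₂ : ℝ → A₁} (h : IsRepr ι θ p z x₁ x₂)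
    (k : IsRepr ι θ p w y₁ y₂) : IsRepr ι θ p (z - w) (x₁ - y₁) (x₂ - y₂) := by
  have := h.add (k.smul (-1))
  simpa only [neg_smul, one_smul, ← sub_eq_add_neg] using this

theorem IsRepr.eLpNorm₀_eq {z : A₁} {x₁ : ℝ → A₀} {x₂ : ℝ → A₁} (h : IsRepr ι θ p z x₁ x₂) :
    eLpNorm (fun t => Real.exp (θ * t) • x₁ t) (ENNReal.ofReal p) volume =
      ENNReal.ofReal (lpNorm₀ θ p x₁) :=
  (ENNReal.ofReal_toReal h.memLp₀.eLpNorm_ne_top).symm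

theorem IsRepr.eLpNorm₁_eq {z : A₁} {x₁ : ℝ → A₀} {x₂ : ℝ → A₁} (h : IsRepr ι θ p z x₁ x₂) :
    eLpNorm (fun t => Real.exp (-(1 - θ) * t) • x₂ t) (ENNReal.ofReal p) volume =
      ENNReal.ofReal (lpNorm₁ θ p x₂) :=
  (ENNReal.ofReal_toReal h.memLp₁.eLpNorm_ne_top).symm

/-- A fast Cauchy sequence in the interpolation space is represented by fast Cauchy sequences. -/
theorem exists_isRepr_seq {u : ℕ → LionsPeetre ι θ p}
    (hu : ∀ n, ‖u (n + 1) - u n‖ < (1 / 2) ^ n) : ∃ (P : ℕ → ℝ → A₀) (Q : ℕ → ℝ → A₁),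
      (∀ n, IsRepr ι θ p (LionsPeetre.incl ι θ p (u n)) (P n) (Q n)) ∧
      ∀ m n, m ≤ n → lpNorm₀ θ p (P n - P m) ≤ 2 * (1 / 2) ^ m - 2 * (1 / 2) ^ n ∧
        lpNorm₁ θ p (Q n - Q m) ≤ 2 * (1 / 2) ^ m - 2 * (1 / 2) ^ n := by
  obtain ⟨a₀, b₀, h₀⟩ := (u 0).exists_repr
  choose a b hab ha hb using fun n => exists_repr_lt (u (n + 1) - u n).exists_repr (hu n)
  have hP : ∀ n, IsRepr ι θ p (LionsPeetre.incl ι θ p (u n)) (a₀ + ∑ j ∈ Finset.range n, a j)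
      (b₀ + ∑ j ∈ Finset.range n, b j) := by
    intro n
    induction n with
    | zero => simpa using h₀
    | succ n ih =>
      have := ih.add (hab n)
      rwa [← map_add, add_sub_cancel, add_assoc, add_assoc, ← Finset.sum_range_succ,
        ← Finset.sum_range_succ] at this
  refine ⟨_, _, hP, fun m n hmn => ?_⟩
  induction n, hmn using Nat.le_induction with
  | base => simp [lpNorm₀, lpNorm₁]
  | succ n hmn ih =>
    have hd := (hP n).sub (hP m)
    have e₀ := hd.lpNorm₀_add_le (hab n)
    have e₁ := hd.lpNorm₁_add_le (hab n)
    have i₀ : a₀ + ∑ j ∈ Finset.range (n + 1), a j - (a₀ + ∑ j ∈ Finset.range m, a j) =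
        a₀ + ∑ j ∈ Finset.range n, a j - (a₀ + ∑ j ∈ Finset.range m, a j) + a n := by
      rw [Finset.sum_range_succ]; abel
    have i₁ : b₀ + ∑ j ∈ Finset.range (n + 1), b j - (b₀ + ∑ j ∈ Finset.range m, b j) =
        b₀ + ∑ j ∈ Finset.range n, b j - (b₀ + ∑ j ∈ Finset.range m, b j) + b n := by
      rw [Finset.sum_range_succ]; abel
    rw [i₀, i₁]
    have := ha n
    have := hb n
    have hpow : (1 / 2 : ℝ) ^ (n + 1) = (1 / 2) ^ n / 2 := by rw [pow_succ]; ring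
    rw [hpow]
    exact ⟨e₀.trans (by linarith [ih.1]), e₁.trans (by linarith [ih.2])⟩

instance [CompleteSpace A₀] [CompleteSpace A₁] : CompleteSpace (LionsPeetre ι θ p) := by
  refine Metric.complete_of_convergent_controlled_sequences (fun n => (1 / 2) ^ n) (by simp)
    fun u hu => ?_
  have hu' : ∀ n, ‖u (n + 1) - u n‖ < (1 / 2) ^ n := fun n => by
    rw [← dist_eq_norm]; exact hu n _ _ n.le_succ le_rfl
  have hcau : CauchySeq u := cauchySeq_of_le_geometric (1 / 2) 1 (by norm_num) fun n => by
    rw [one_mul, dist_comm, dist_eq_norm]; exact (hu' n).le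
  obtain ⟨z, hz⟩ := cauchySeq_tendsto_of_complete
    ((LionsPeetre.inclL ι θ p).uniformContinuous.comp_cauchySeq hcau)
  replace hz : Tendsto (fun n => LionsPeetre.incl ι θ p (u n)) atTop (𝓝 z) := hz
  obtain ⟨P, Q, hPQ, hPQd⟩ := exists_isRepr_seq hu'
  have hpow : ∀ n : ℕ, (0 : ℝ) < (1 / 2) ^ n := fun n => by positivity
  have hd₀ : ∀ m n, m ≤ n → eLpNorm (fun t => Real.exp (θ * t) • (P n - P m) t)
      (ENNReal.ofReal p) volume ≤ ENNReal.ofReal (2 * (1 / 2) ^ m) := fun m n hmn => by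
    rw [((hPQ n).sub (hPQ m)).eLpNorm₀_eq]
    exact ENNReal.ofReal_le_ofReal (by linarith [(hPQd m n hmn).1, hpow n])
  have hd₁ : ∀ m n, m ≤ n → eLpNorm (fun t => Real.exp (-(1 - θ) * t) • (Q n - Q m) t)
      (ENNReal.ofReal p) volume ≤ ENNReal.ofReal (2 * (1 / 2) ^ m) := fun m n hmn => by
    rw [((hPQ n).sub (hPQ m)).eLpNorm₁_eq]
    exact ENNReal.ofReal_le_ofReal (by linarith [(hPQd m n hmn).2, hpow n])
  have hae : ∀ᵐ t, ∃ y, Tendsto (fun n => Real.exp (θ * t) • P n t) atTop (𝓝 y) := by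
    refine Lp.ae_tendsto_of_cauchy_eLpNorm (p := ENNReal.ofReal p)
      (B := fun n => ENNReal.ofReal (3 * (1 / 2) ^ n)) (fun n => (hPQ n).memLp₀.1)
      (one_le_ofReal_exponent p)
      ((summable_geometric_of_lt_one (by norm_num) (by norm_num)).mul_left 3).tsum_ofReal_ne_top
      fun N n m hn hm => ?_
    have key : ∀ n m, N ≤ m → m ≤ n → eLpNorm ((fun t => Real.exp (θ * t) • P n t) -
        fun t => Real.exp (θ * t) • P m t) (ENNReal.ofReal p) volume <
          ENNReal.ofReal (3 * (1 / 2) ^ N) := fun n m hm hmn => by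
      have e : ((fun t => Real.exp (θ * t) • P n t) - fun t => Real.exp (θ * t) • P m t) =
          fun t => Real.exp (θ * t) • (P n - P m) t := by
        ext t; rw [Pi.sub_apply, Pi.sub_apply, smul_sub]
      rw [e]
      refine (hd₀ m n hmn).trans_lt ?_
      rw [ENNReal.ofReal_lt_ofReal_iff (by positivity)]
      have : (1 / 2 : ℝ) ^ m ≤ (1 / 2) ^ N :=
        pow_le_pow_of_le_one (by norm_num) (by norm_num) hm
      linarith [hpow N]
    rcases le_total m n with h | h
    · exact key n m hm h
    · rw [eLpNorm_sub_comm]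
      exact key m n hn h
  have hlim : ∀ᵐ t, Tendsto (fun n => P n t) atTop (𝓝 (limUnder atTop fun n => P n t)) := by
    filter_upwards [hae] with t ⟨y, hy⟩
    refine tendsto_nhds_limUnder ⟨(Real.exp (θ * t))⁻¹ • y, ?_⟩
    refine (hy.const_smul (Real.exp (θ * t))⁻¹).congr fun n => ?_
    rw [smul_smul, inv_mul_cancel₀ (Real.exp_ne_zero _), one_smul]
  set x₁ : ℝ → A₀ := fun t => limUnder atTop fun n => P n t with hx₁
  set x₂ : ℝ → A₁ := fun t => z - ι (x₁ t) with hx₂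
  have hlim₀ : ∀ m, ∀ᵐ t, Tendsto (fun n => Real.exp (θ * t) • (P n - P m) t) atTop
      (𝓝 (Real.exp (θ * t) • (x₁ - P m) t)) := fun m => by
    filter_upwards [hlim] with t ht
    exact (ht.sub_const _).const_smul _
  have hlim₁ : ∀ m, ∀ᵐ t, Tendsto (fun n => Real.exp (-(1 - θ) * t) • (Q n - Q m) t) atTop
      (𝓝 (Real.exp (-(1 - θ) * t) • (x₂ - Q m) t)) := fun m => by
    filter_upwards [hlim] with t ht
    have hQ : Tendsto (fun n => Q n t) atTop (𝓝 (x₂ t)) := by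
      refine (hz.sub ((ι.continuous.tendsto _).comp ht)).congr fun n => ?_
      rw [← (hPQ n).add_eq t, Function.comp_apply, add_sub_cancel_left]
    exact (hQ.sub_const _).const_smul _
  have hrep : ∀ m, IsRepr ι θ p (z - LionsPeetre.incl ι θ p (u m)) (x₁ - P m) (x₂ - Q m) ∧
      lpNorm₀ θ p (x₁ - P m) ≤ 2 * (1 / 2) ^ m ∧ lpNorm₁ θ p (x₂ - Q m) ≤ 2 * (1 / 2) ^ m := by
    intro m
    have n₀ := Lp.eLpNorm_le_of_ae_tendsto ((eventually_ge_atTop m).mono fun n hn => hd₀ m n hn)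
      (fun n => ((hPQ n).sub (hPQ m)).memLp₀.1) (hlim₀ m)
    have n₁ := Lp.eLpNorm_le_of_ae_tendsto ((eventually_ge_atTop m).mono fun n hn => hd₁ m n hn)
      (fun n => ((hPQ n).sub (hPQ m)).memLp₁.1) (hlim₁ m)
    refine ⟨⟨⟨aestronglyMeasurable_of_tendsto_ae atTop
      (fun n => ((hPQ n).sub (hPQ m)).memLp₀.1) (hlim₀ m), n₀.trans_lt ENNReal.ofReal_lt_top⟩,
      ⟨aestronglyMeasurable_of_tendsto_ae atTop
      (fun n => ((hPQ n).sub (hPQ m)).memLp₁.1) (hlim₁ m), n₁.trans_lt ENNReal.ofReal_lt_top⟩,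
      fun t => ?_⟩, ENNReal.toReal_le_of_le_ofReal (by positivity) n₀,
      ENNReal.toReal_le_of_le_ofReal (by positivity) n₁⟩
    rw [← (hPQ m).add_eq t, Pi.sub_apply, Pi.sub_apply, map_sub,
      show x₂ t = z - ι (x₁ t) from rfl]
    generalize ι (x₁ t) = w
    abel
  have hmem : z ∈ lionsPeetreSubmodule ι θ p := by
    have := (lionsPeetreSubmodule ι θ p).add_mem ⟨_, _, (hrep 0).1⟩ (u 0).2
    rwa [← sub_add_cancel z (LionsPeetre.incl ι θ p (u 0))]
  let w : LionsPeetre ι θ p := ⟨z, hmem⟩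
  refine ⟨w, ?_⟩
  rw [tendsto_iff_norm_sub_tendsto_zero]
  refine squeeze_zero (fun n => norm_nonneg _) (g := fun n => 2 * (1 / 2) ^ n) (fun n => ?_) ?_
  · rw [norm_sub_rev]
    exact (hrep n).1.norm_le (hrep n).2.1 (hrep n).2.2
  · simpa using (tendsto_pow_atTop_nhds_zero_of_lt_one (r := (1 / 2 : ℝ)) (by norm_num)
      (by norm_num)).const_mul 2

end Completeness

/-! ### The space `A₀` -/

section KernelFunctions

variable {X : Type*} [NormedAddCommGroup X] [MeasurableSpace X] [BorelSpace X]

theorem Phi_toSignedMeasure (m : Measure X) [IsFiniteMeasure m] (y : X) :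
    Phi X m.toSignedMeasure y = ∫ x, Real.exp (-‖x - y‖) ∂m := by
  have h : ContinuousLinearMap.lsmul ℝ ℝ = (ContinuousLinearMap.lsmul ℝ ℝ).flip (E := ℝ) := by
    ext; simp
  rw [Phi_apply, h, VectorMeasure.integral_toSignedMeasure]

theorem Phi_eq_sub_jordan (μ : SignedMeasure X) :
    Phi X μ = Phi X μ.toJordanDecomposition.posPart.toSignedMeasure -
      Phi X μ.toJordanDecomposition.negPart.toSignedMeasure := by
  rw [← map_sub]
  exact congrArg (Phi X) (SignedMeasure.toSignedMeasure_toJordanDecomposition μ).symm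

theorem integrable_exp_neg_norm_sub (m : Measure X) [IsFiniteMeasure m] (y : X) :
    Integrable (fun x => Real.exp (-‖x - y‖)) m :=
  Integrable.of_bound (C := 1)
    (Continuous.aestronglyMeasurable (by fun_prop)) (Eventually.of_forall fun x => by
    rw [Real.norm_of_nonneg (Real.exp_nonneg _)]
    exact Real.exp_le_one_iff.2 (by simp))

/-- Summation of an absolutely convergent series of signed measures. -/
theorem exists_hasSum_Phi {μ : ℕ → SignedMeasure X} {b : ℕ → ℝ} (hb : Summable b)
    (hμ : ∀ j, (μ j).variation.real Set.univ ≤ b j) :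
    ∃ ν : SignedMeasure X, ν.variation.real Set.univ ≤ ∑' j, b j ∧
      ∀ y, HasSum (fun j => Phi X (μ j) y) (Phi X ν y) := by
  have hb0 : ∀ j, 0 ≤ b j := fun j => measureReal_nonneg.trans (hμ j)
  set P := Measure.sum fun j => (μ j).toJordanDecomposition.posPart with hP
  set N := Measure.sum fun j => (μ j).toJordanDecomposition.negPart with hN
  have hPN : (P + N) Set.univ ≤ ENNReal.ofReal (∑' j, b j) := by
    rw [Measure.add_apply, hP, hN, Measure.sum_apply _ MeasurableSet.univ,
      Measure.sum_apply _ MeasurableSet.univ, ← ENNReal.tsum_add, ENNReal.ofReal_tsum_of_nonneg hb0 hb]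
    refine ENNReal.tsum_le_tsum fun j => ?_
    have h : (μ j).toJordanDecomposition.posPart Set.univ +
        (μ j).toJordanDecomposition.negPart Set.univ = (μ j).variation Set.univ := by
      rw [← SignedMeasure.totalVariation_eq_variation]; rfl
    rw [h, ← ofReal_measureReal]
    exact ENNReal.ofReal_le_ofReal (hμ j)
  have : IsFiniteMeasure (P + N) := ⟨hPN.trans_lt ENNReal.ofReal_lt_top⟩
  have : IsFiniteMeasure P := isFiniteMeasure_of_le (P + N) (Measure.le_add_right le_rfl)
  have : IsFiniteMeasure N := isFiniteMeasure_of_le (P + N) (Measure.le_add_left le_rfl)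
  refine ⟨P.toSignedMeasure - N.toSignedMeasure, ?_, fun y => ?_⟩
  · refine ENNReal.toReal_le_of_le_ofReal (tsum_nonneg hb0) (le_trans ?_ hPN)
    have := VectorMeasure.variation_sub_le (μ := P.toSignedMeasure) (ν := N.toSignedMeasure) Set.univ
    rwa [Measure.variation_toSignedMeasure, Measure.variation_toSignedMeasure] at this
  · simp_rw [Phi_eq_sub_jordan (μ _)]
    rw [map_sub]
    simp_rw [BoundedContinuousFunction.sub_apply, Phi_toSignedMeasure]
    exact (hasSum_integral_measure (integrable_exp_neg_norm_sub P y)).sub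
      (hasSum_integral_measure (integrable_exp_neg_norm_sub N y))

instance : CompleteSpace (PhiRange X) := by
  refine Metric.complete_of_convergent_controlled_sequences (fun n => (1 / 2) ^ n) (by simp)
    fun u hu => ?_
  have hu' : ∀ n, ‖u (n + 1) - u n‖ < (1 / 2) ^ n := fun n => by
    rw [← dist_eq_norm]; exact hu n _ _ n.le_succ le_rfl
  choose μ hμ hμlt using fun n => PhiRange.exists_measure_lt (hu' n)
  have hsum : Summable fun n : ℕ => (1 / 2 : ℝ) ^ n := summable_geometric_two
  choose ν hν hνsum using fun m : ℕ => exists_hasSum_Phi (μ := fun j => μ (j + m))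
    ((summable_nat_add_iff m).2 hsum) fun j => (hμlt (j + m)).le
  have htail : ∀ m : ℕ, ∑' j : ℕ, (1 / 2 : ℝ) ^ (j + m) = 2 * (1 / 2) ^ m := fun m => by
    simp_rw [pow_add]
    rw [tsum_mul_right, tsum_geometric_two]
  have hpt : ∀ m y, PhiRange.inclₗ X (u 0) y + Phi X (ν 0) y =
      PhiRange.inclₗ X (u m) y + Phi X (ν m) y := by
    intro m y
    have h0 := hνsum 0 y
    simp only [add_zero] at h0
    have h1 := (hasSum_nat_add_iff (f := fun j => Phi X (μ j) y) m).1 (hνsum m y)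
    have h2 : ∑ j ∈ Finset.range m, Phi X (μ j) y =
        PhiRange.inclₗ X (u m) y - PhiRange.inclₗ X (u 0) y := by
      rw [← Finset.sum_range_sub fun j => PhiRange.inclₗ X (u j) y]
      refine Finset.sum_congr rfl fun j _ => ?_
      rw [hμ, map_sub, BoundedContinuousFunction.sub_apply]
    have := h0.unique h1
    linarith
  let w : PhiRange X := u 0 + ⟨Phi X (ν 0), ν 0, rfl⟩
  have hw : ∀ m, Phi X (ν m) = PhiRange.inclₗ X (w - u m) := fun m => by
    ext y
    rw [map_sub]
    change _ = PhiRange.inclₗ X (u 0) y + Phi X (ν 0) y - PhiRange.inclₗ X (u m) y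
    rw [hpt m y, add_sub_cancel_left]
  refine ⟨w, ?_⟩
  rw [tendsto_iff_norm_sub_tendsto_zero]
  refine squeeze_zero (fun n => norm_nonneg _) (g := fun n => 2 * (1 / 2) ^ n) (fun n => ?_) ?_
  · rw [norm_sub_rev, ← htail n]
    exact (PhiRange.norm_le_of_eq (hw n)).trans (hν n)
  · simpa using (tendsto_pow_atTop_nhds_zero_of_lt_one (r := (1 / 2 : ℝ)) (by norm_num)
      (by norm_num)).const_mul 2

/-- The function `y ↦ exp (-‖x - y‖)`, as an element of `A₀`. -/
def kernelFun (x : X) : PhiRange X := ⟨Phi X (Measure.dirac x).toSignedMeasure, _, rfl⟩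

theorem incl_kernelFun_apply (x y : X) :
    PhiRange.incl X (kernelFun x) y = Real.exp (-‖x - y‖) := by
  change Phi X (Measure.dirac x).toSignedMeasure y = _
  rw [Phi_toSignedMeasure, integral_dirac]

theorem norm_kernelFun_le (x : X) : ‖kernelFun x‖ ≤ 1 := by
  refine (PhiRange.norm_le_of_eq (f := kernelFun x)
    (μ := (Measure.dirac x).toSignedMeasure) rfl).trans ?_
  rw [Measure.variation_toSignedMeasure]
  simp

theorem abs_exp_neg_sub_exp_neg_le {a b : ℝ} (ha : 0 ≤ a) (hb : 0 ≤ b) :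
    |Real.exp (-a) - Real.exp (-b)| ≤ |a - b| := by
  wlog h : a ≤ b generalizing a b
  · rw [abs_sub_comm, abs_sub_comm a]
    exact this hb ha (le_of_not_ge h)
  rw [abs_of_nonneg (sub_nonneg.2 (Real.exp_le_exp.2 (neg_le_neg h))),
    abs_of_nonpos (sub_nonpos.2 h)]
  have h1 : Real.exp (-b) = Real.exp (-a) * Real.exp (a - b) := by rw [← Real.exp_add]; congr 1; ring
  have h2 := Real.add_one_le_exp (a - b)
  have h3 : Real.exp (-a) ≤ 1 := Real.exp_le_one_iff.2 (by linarith)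
  have h4 := Real.exp_pos (-a)
  rw [h1]
  nlinarith

variable (θ : Set.Ioo (0 : ℝ) 1) (p : Set.Ioi (1 : ℝ))

/-- The function `y ↦ exp (-‖x - y‖)`, as an element of `R`. -/
def RSpace.kernelFun (x : X) : RSpace X θ p :=
  LionsPeetre.ofA₀ (PhiRange.incl X) θ p (StableBanach.kernelFun x)

theorem RSpace.incl_kernelFun_apply (x y : X) :
    LionsPeetre.incl (PhiRange.incl X) θ p (RSpace.kernelFun θ p x) y = Real.exp (-‖x - y‖) :=
  StableBanach.incl_kernelFun_apply x y

theorem RSpace.ext {r s : RSpace X θ p} (h : ∀ y, LionsPeetre.incl (PhiRange.incl X) θ p r y =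
    LionsPeetre.incl (PhiRange.incl X) θ p s y) : r = s :=
  LionsPeetre.incl_injective (BoundedContinuousFunction.ext h)

theorem RSpace.translation_kernelFun (x z : X) :
    translation θ p z (RSpace.kernelFun θ p x) = RSpace.kernelFun θ p (x + z) := by
  refine RSpace.ext θ p fun y => ?_
  rw [translation_apply, RSpace.incl_kernelFun_apply, RSpace.incl_kernelFun_apply, sub_sub_eq_add_sub]

theorem RSpace.continuous_kernelFun : Continuous (RSpace.kernelFun θ p : X → RSpace X θ p) := by
  rw [Metric.continuous_iff]
  intro x ε hε
  obtain ⟨δ, hδ, h⟩ := LionsPeetre.exists_norm_le_of_norm_incl_le (PhiRange.incl X) θ p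
    (M := 1 + 1) (by norm_num) (half_pos hε)
  refine ⟨δ, hδ, fun y hy => ?_⟩
  rw [dist_eq_norm] at hy ⊢
  refine (h _ ?_ ?_).trans_lt (half_lt_self hε)
  · refine subset_closure ⟨StableBanach.kernelFun y - StableBanach.kernelFun x, ?_, ?_⟩
    · rw [mem_closedBall_zero_iff]
      exact (norm_sub_le _ _).trans (add_le_add (norm_kernelFun_le y) (norm_kernelFun_le x))
    · rw [map_sub, map_sub]; rfl
  · refine (BoundedContinuousFunction.norm_le hδ.le).2 fun z => ?_
    rw [map_sub, BoundedContinuousFunction.sub_apply, RSpace.incl_kernelFun_apply,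
      RSpace.incl_kernelFun_apply, Real.norm_eq_abs]
    refine (abs_exp_neg_sub_exp_neg_le (norm_nonneg _) (norm_nonneg _)).trans
      ((abs_norm_sub_norm_le _ _).trans ?_)
    rw [sub_sub_sub_cancel_right]
    exact hy.le

/-- The functions `y ↦ exp (-‖x - y‖)` span a dense subspace of `R`. -/
theorem RSpace.topologicalClosure_span_kernelFun [SecondCountableTopology X] :
    (Submodule.span ℝ (Set.range (RSpace.kernelFun θ p : X → RSpace X θ p))).topologicalClosure =
      ⊤ := by
  set V := (Submodule.span ℝ
    (Set.range (RSpace.kernelFun θ p : X → RSpace X θ p))).topologicalClosure with hV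
  have hVc : IsClosed (V : Set (RSpace X θ p)) := Submodule.isClosed_topologicalClosure _
  have hk : ∀ x, RSpace.kernelFun θ p x ∈ V := fun x =>
    Submodule.le_topologicalClosure _ (Submodule.subset_span ⟨x, rfl⟩)
  have hint : ∀ (m : Measure X) [IsFiniteMeasure m], Integrable (RSpace.kernelFun θ p) m := by
    intro m _
    obtain ⟨C, hC⟩ : ∃ C, ∀ x : X, ‖RSpace.kernelFun θ p x‖ ≤ C := by
      refine ⟨‖RSpace.kernelFun θ p (0 : X)‖, fun x => ?_⟩
      have := RSpace.translation_kernelFun θ p 0 x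
      rw [zero_add] at this
      rw [← this, LinearIsometryEquiv.norm_map]
    exact Integrable.of_bound (RSpace.continuous_kernelFun θ p).aestronglyMeasurable C
      (Eventually.of_forall hC)
  have hmem : ∀ (m : Measure X) [IsFiniteMeasure m], ∫ x, RSpace.kernelFun θ p x ∂m ∈ V := by
    intro m _
    rcases eq_or_ne m 0 with rfl | hm
    · rw [integral_zero_measure]
      exact V.zero_mem
    have : NeZero m := ⟨hm⟩
    have h := (V.convex).average_mem hVc (Eventually.of_forall hk) (hint m)
    rw [average_eq] at h
    have := V.smul_mem (m.real Set.univ) h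
    rwa [smul_smul, mul_inv_cancel₀ (by simpa [measureReal_eq_zero_iff] using hm), one_smul] at this
  have happly : ∀ (m : Measure X) [IsFiniteMeasure m] (y : X),
      LionsPeetre.incl (PhiRange.incl X) θ p (∫ x, RSpace.kernelFun θ p x ∂m) y =
        Phi X m.toSignedMeasure y := by
    intro m _ y
    rw [Phi_toSignedMeasure]
    have := ((BoundedContinuousFunction.evalCLM ℝ y).comp
      (LionsPeetre.inclL (PhiRange.incl X) θ p)).integral_comp_comm (hint m)
    refine this.symm.trans (integral_congr_ae (Eventually.of_forall fun x => ?_))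
    exact RSpace.incl_kernelFun_apply θ p x y
  rw [eq_top_iff]
  intro r _
  refine closure_minimal ?_ hVc (LionsPeetre.denseRange_ofA₀ (PhiRange.incl X) θ p r)
  rintro _ ⟨f, rfl⟩
  obtain ⟨μ, hμ⟩ := f.exists_measure
  have : LionsPeetre.ofA₀ (PhiRange.incl X) θ p f =
      (∫ x, RSpace.kernelFun θ p x ∂μ.toJordanDecomposition.posPart) -
        ∫ x, RSpace.kernelFun θ p x ∂μ.toJordanDecomposition.negPart := by
    refine RSpace.ext θ p fun y => ?_
    rw [map_sub, BoundedContinuousFunction.sub_apply, happly, happly]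
    change PhiRange.inclₗ X f y = _
    rw [← hμ, Phi_eq_sub_jordan]
    rfl
  rw [this]
  exact V.sub_mem (hmem _) (hmem _)

end KernelFunctions

/-! ### Weak limits of translations -/

section WeakLimits

theorem norm_le_of_tendsto_dual {E κ : Type*} [NormedAddCommGroup E] [NormedSpace ℝ E]
    {l : Filter κ} [l.NeBot] {v : κ → E} {w : E} {C : ℝ} (hv : ∀ i, ‖v i‖ ≤ C)
    (h : ∀ φ : E →L[ℝ] ℝ, Tendsto (fun i => φ (v i)) l (𝓝 (φ w))) : ‖w‖ ≤ C := by
  obtain ⟨φ, hφ, hφw⟩ := exists_dual_vector'' ℝ w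
  have hφw' : φ w = ‖w‖ := hφw
  rw [← hφw']
  refine le_of_tendsto' (h φ) fun i => (Real.le_norm_self _).trans ((φ.le_opNorm _).trans ?_)
  exact (mul_le_of_le_one_left (norm_nonneg _) hφ).trans (hv i)

/-- A family of contractions that converges weakly on a set with dense span converges in the weak
operator topology. -/
theorem exists_tendsto_dual_apply {E κ : Type*} [NormedAddCommGroup E] [NormedSpace ℝ E]
    [CompleteSpace E] {l : Filter κ} [l.NeBot] {U : κ → E →L[ℝ] E} (hU : ∀ i r, ‖U i r‖ ≤ ‖r‖)
    {D : Set E} (hD : (Submodule.span ℝ D).topologicalClosure = ⊤)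
    (h : ∀ r ∈ D, ∃ w, ∀ φ : E →L[ℝ] ℝ, Tendsto (fun i => φ (U i r)) l (𝓝 (φ w))) :
    ∃ T : E →L[ℝ] E, ∀ r (φ : E →L[ℝ] ℝ), Tendsto (fun i => φ (U i r)) l (𝓝 (φ (T r))) := by
  have hspan : ∀ r : Submodule.span ℝ D, ∃ w, ∀ φ : E →L[ℝ] ℝ,
      Tendsto (fun i => φ (U i r)) l (𝓝 (φ w)) := by
    rintro ⟨r, hr⟩
    induction hr using Submodule.span_induction with
    | mem r hr => exact h r hr
    | zero => exact ⟨0, fun φ => by simp⟩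
    | add r s _ _ hr hs =>
      obtain ⟨w, hw⟩ := hr
      obtain ⟨v, hv⟩ := hs
      exact ⟨w + v, fun φ => by simpa using (hw φ).add (hv φ)⟩
    | smul c r _ hr =>
      obtain ⟨w, hw⟩ := hr
      exact ⟨c • w, fun φ => by simpa using (hw φ).const_mul c⟩
  choose w hw using hspan
  have huniq : ∀ (r : Submodule.span ℝ D) (v : E),
      (∀ φ : E →L[ℝ] ℝ, Tendsto (fun i => φ (U i r)) l (𝓝 (φ v))) → w r = v := fun r v hv =>
    (SeparatingDual.eq_iff_forall_dual_eq (R := ℝ)).2 fun φ => tendsto_nhds_unique (hw r φ) (hv φ)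
  let T₀ : Submodule.span ℝ D →ₗ[ℝ] E :=
    { toFun := w
      map_add' := fun r s => huniq _ _ fun φ => by simpa using (hw r φ).add (hw s φ)
      map_smul' := fun c r => huniq _ _ fun φ => by simpa using (hw r φ).const_mul c }
  let T₁ : Submodule.span ℝ D →L[ℝ] E := T₀.mkContinuous 1 fun r => by
    rw [one_mul]
    exact norm_le_of_tendsto_dual (fun i => hU i r) (hw r)
  have hdense : DenseRange (Submodule.span ℝ D).subtypeL := by
    intro r
    have : r ∈ (Submodule.span ℝ D).topologicalClosure := hD ▸ Submodule.mem_top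
    rw [← SetLike.mem_coe, Submodule.topologicalClosure_coe] at this
    simpa using! this
  have hind : IsUniformInducing (Submodule.span ℝ D).subtypeL := isUniformEmbedding_subtype_val.1
  let T := T₁.extend (Submodule.span ℝ D).subtypeL
  have hTr : ∀ r, T ((Submodule.span ℝ D).subtypeL r) = w r := fun r =>
    ContinuousLinearMap.extend_eq T₁ hdense hind r
  have hTn : ∀ r, ‖T r‖ ≤ ‖r‖ := fun r => by
    refine isClosed_property hdense (isClosed_le T.continuous.norm continuous_norm) (fun s => ?_) r
    rw [hTr]
    exact norm_le_of_tendsto_dual (fun i => hU i s) (hw s)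
  refine ⟨T, fun r φ => ?_⟩
  have hLip : ∀ A : E →L[ℝ] E, (∀ r, ‖A r‖ ≤ ‖r‖) → ∀ z v, |φ (A z) - φ (A v)| ≤ ‖φ‖ * ‖z - v‖ :=
    fun A hA z v => by
      rw [← map_sub, ← map_sub, ← Real.norm_eq_abs]
      exact (φ.le_opNorm _).trans (mul_le_mul_of_nonneg_left (hA _) (norm_nonneg _))
  refine tendsto_of_forall_denseRange hdense (F := fun i r => φ (U i r)) (f := fun r => φ (T r))
    (norm_nonneg φ) (fun i => hLip _ (hU i)) (hLip _ hTn) (fun s => ?_) r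
  rw [hTr]
  exact hw s φ

variable {X : Type*} [NormedAddCommGroup X]

/-- The function `y ↦ exp (-σ (-y))`. -/
def typeFun (σ : TypeSpace X) : X →ᵇ ℝ :=
  BoundedContinuousFunction.ofNormedAddCommGroup (fun y => Real.exp (-σ.1 (-y)))
    (Real.continuous_exp.comp (((LipschitzWith.of_dist_le_mul (K := 1) fun z w => by
      rw [Real.dist_eq, dist_eq_norm, NNReal.coe_one, one_mul]
      exact σ.abs_sub_le z w).continuous.comp continuous_neg).neg)) 1 fun y => by
    rw [Real.norm_of_nonneg (Real.exp_nonneg _)]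
    exact Real.exp_le_one_iff.2 (neg_nonpos.2 (σ.nonneg _))

theorem tendsto_exp_neg_type {ι : Type*} {l : Filter ι} {x : ι → X} (τ : TypeSpace X)
    (hx : Tendsto x l (Bornology.cobounded X)) :
    Tendsto (fun i => Real.exp (-τ.1 (x i))) l (𝓝 0) := by
  refine Real.tendsto_exp_neg_atTop_nhds_zero.comp ?_
  refine tendsto_atTop_mono (fun i => τ.norm_sub_apply_le (x i)) ?_
  exact tendsto_atTop_add_const_right _ _ (tendsto_norm_cobounded_atTop.comp hx)

variable [MeasurableSpace X] [BorelSpace X] (θ : Set.Ioo (0 : ℝ) 1) (p : Set.Ioi (1 : ℝ))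

theorem tendsto_toWOT_iff {ι : Type*} {l : Filter ι} {x : ι → X}
    {A : RSpace X θ p →WOT[ℝ] RSpace X θ p} :
    Tendsto (fun i => toWOT θ p (translation θ p (x i))) l (𝓝 A) ↔
      ∀ r (φ : RSpace X θ p →L[ℝ] ℝ),
        Tendsto (fun i => φ (translation θ p (x i) r)) l (𝓝 (φ (A r))) :=
  ContinuousLinearMapWOT.tendsto_iff_forall_dual_apply_tendsto

theorem tendsto_dual_translation_kernelFun {l : Filter X} {z : RSpace X θ p}
    (hz : ∀ φ : RSpace X θ p →L[ℝ] ℝ,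
      Tendsto (fun x => φ (RSpace.kernelFun θ p x)) l (𝓝 (φ z))) (y : X)
    (φ : RSpace X θ p →L[ℝ] ℝ) :
    Tendsto (fun x => φ (translation θ p x (RSpace.kernelFun θ p y))) l
      (𝓝 (φ (translation θ p y z))) := by
  refine (hz (φ.comp (translation θ p y : RSpace X θ p →L[ℝ] RSpace X θ p))).congr fun x => ?_
  change φ (translation θ p y (RSpace.kernelFun θ p x)) = _
  rw [RSpace.translation_kernelFun, RSpace.translation_kernelFun, add_comm]

variable [TopologicalSpace.SeparableSpace X]

/-- Along an ultrafilter that tends to infinity, or whose opposite converges to a type, all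
functions `y ↦ exp (-‖x - y‖)` have a limit. -/
theorem ultrafilter_cases (u : Ultrafilter X) :
    (Tendsto (fun y => -y) u (Bornology.cobounded X) ∧
      ∀ x, Tendsto (PhiRange.incl X (kernelFun x)) u (𝓝 0)) ∨
    ∃ τ : TypeSpace X, Tendsto (fun y => degenerate (-y)) u (𝓝 τ) ∧
      ∀ x, Tendsto (PhiRange.incl X (kernelFun x)) u (𝓝 (Real.exp (-τ.1 x))) := by
  have hk : ∀ x y, PhiRange.incl X (kernelFun x) y = Real.exp (-(degenerate x).1 (-y)) :=
    fun x y => by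
      rw [incl_kernelFun_apply, norm_sub_rev, ← norm_neg, neg_sub, sub_eq_neg_add]; rfl
  rcases exists_ultrafilter_tendsto_degenerate (u.map fun y => -y) with h | ⟨τ, hτ⟩
  · have h' : Tendsto (fun y => -y) u (Bornology.cobounded X) := h
    refine Or.inl ⟨h', fun x => ?_⟩
    simp_rw [funext (hk x)]
    exact tendsto_exp_neg_type (degenerate x) h'
  · have hτ' : Tendsto (fun y => degenerate (-y)) u (𝓝 τ) := hτ
    refine Or.inr ⟨τ, hτ', fun x => ?_⟩
    refine ((Real.continuous_exp.tendsto _).comp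
      (tendsto_degenerate_iff.1 hτ' x).neg).congr fun y => ?_
    rw [incl_kernelFun_apply, sub_eq_add_neg]; rfl

theorem tendsto_dual_kernelFun_cobounded (φ : RSpace X θ p →L[ℝ] ℝ) :
    Tendsto (fun x => φ (RSpace.kernelFun θ p x)) (Bornology.cobounded X) (𝓝 (φ 0)) := by
  refine LionsPeetre.tendsto_dual_ofA₀ (g := kernelFun) norm_kernelFun_le (fun S hS => ?_) φ
  rw [map_zero]
  refine mem_closure_convexHull_image (l := Bornology.cobounded X) (M := 1) (fun x =>
    (PhiRange.norm_incl_le' _).trans (norm_kernelFun_le x)) (fun u => ?_) hS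
  rcases ultrafilter_cases u with ⟨-, h⟩ | ⟨τ, -, h⟩
  · exact ⟨fun _ => 0, 0, h, tendsto_const_nhds, tendsto_const_nhds⟩
  · exact ⟨_, 0, h, tendsto_const_nhds, tendsto_exp_neg_type τ tendsto_id⟩

theorem exists_tendsto_dual_kernelFun (hX : IsStable X) (σ : TypeSpace X) :
    ∃ z : RSpace X θ p, ∀ φ : RSpace X θ p →L[ℝ] ℝ,
      Tendsto (fun x => φ (RSpace.kernelFun θ p x)) (comap degenerate (𝓝 σ)) (𝓝 (φ z)) := by
  have key : ∀ S : Set X, (∃ᶠ x in comap degenerate (𝓝 σ), x ∈ S) →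
      typeFun σ ∈ closure (convexHull ℝ ((fun x => PhiRange.incl X (kernelFun x)) '' S)) := by
    intro S hS
    refine mem_closure_convexHull_image (l := comap degenerate (𝓝 σ)) (M := 1) (fun x =>
      (PhiRange.norm_incl_le' _).trans (norm_kernelFun_le x)) (fun u => ?_) hS
    rcases ultrafilter_cases u with ⟨hu, h⟩ | ⟨τ, hu, h⟩
    · exact ⟨fun _ => 0, 0, h, tendsto_exp_neg_type σ hu, tendsto_const_nhds⟩
    · refine ⟨_, Real.exp (-(conv hX σ τ).1 0), h, ?_, ?_⟩
      · rw [conv_comm]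
        exact (Real.continuous_exp.tendsto _).comp ((tendsto_comap_degenerate_conv hX τ σ).comp
          (tendsto_comap_iff.2 hu)).neg
      · exact (Real.continuous_exp.tendsto _).comp (tendsto_comap_degenerate_conv hX σ τ).neg
  have := isDenseInducing_degenerate.comap_nhds_neBot σ
  have hmem : typeFun σ ∈ closure (PhiRange.incl X '' Metric.closedBall 0 1) := by
    refine closure_mono (convexHull_min ?_ ?_) (key Set.univ (Eventually.of_forall fun x =>
      Set.mem_univ x).frequently)
    · rintro _ ⟨x, -, rfl⟩
      exact ⟨_, by simpa using norm_kernelFun_le x, rfl⟩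
    · exact (convex_closedBall (0 : PhiRange X) 1).linear_image (PhiRange.incl X).toLinearMap
  exact ⟨LionsPeetre.ofMemClosure zero_le_one hmem, fun φ =>
    LionsPeetre.tendsto_dual_ofA₀ norm_kernelFun_le key φ⟩

/-- If the functions `kernelFun x` converge weakly along a filter, so do the translations. -/
theorem exists_tendsto_toWOT {l : Filter X} [l.NeBot] {z : RSpace X θ p}
    (hz : ∀ φ : RSpace X θ p →L[ℝ] ℝ,
      Tendsto (fun x => φ (RSpace.kernelFun θ p x)) l (𝓝 (φ z))) :
    ∃ A : RSpace X θ p →WOT[ℝ] RSpace X θ p,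
      Tendsto (fun x => toWOT θ p (translation θ p x)) l (𝓝 A) := by
  have : SecondCountableTopology X := UniformSpace.secondCountable_of_separable X
  obtain ⟨T, hT⟩ := exists_tendsto_dual_apply (l := l)
    (U := fun x => (translation θ p x : RSpace X θ p →L[ℝ] RSpace X θ p))
    (fun x r => ((translation θ p x).norm_map r).le)
    (RSpace.topologicalClosure_span_kernelFun θ p) (by
      rintro _ ⟨y, rfl⟩
      exact ⟨_, tendsto_dual_translation_kernelFun θ p hz y⟩)
  exact ⟨ContinuousLinearMapWOT.ofCLM T, (tendsto_toWOT_iff θ p).2 hT⟩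

theorem tendsto_toWOT_cobounded {l : Filter X} (hl : l ≤ Bornology.cobounded X) :
    Tendsto (fun x => toWOT θ p (translation θ p x)) l (𝓝 0) := by
  rcases l.eq_or_neBot with rfl | hne
  · exact tendsto_bot
  have hz : ∀ φ : RSpace X θ p →L[ℝ] ℝ,
      Tendsto (fun x => φ (RSpace.kernelFun θ p x)) l (𝓝 (φ 0)) := fun φ =>
    (tendsto_dual_kernelFun_cobounded θ p φ).mono_left hl
  have : SecondCountableTopology X := UniformSpace.secondCountable_of_separable X
  obtain ⟨A, hA⟩ := exists_tendsto_toWOT θ p hz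
  suffices A = 0 from this ▸ hA
  have hker : Submodule.span ℝ (Set.range (RSpace.kernelFun θ p : X → RSpace X θ p)) ≤
      LinearMap.ker (A.toCLM : RSpace X θ p →ₗ[ℝ] RSpace X θ p) := by
    rw [Submodule.span_le]
    rintro _ ⟨y, rfl⟩
    refine (SeparatingDual.eq_iff_forall_dual_eq (R := ℝ)).2 fun φ => ?_
    refine tendsto_nhds_unique ((tendsto_toWOT_iff θ p).1 hA _ φ) ?_
    have := tendsto_dual_translation_kernelFun θ p hz y φ
    rwa [map_zero] at this
  have htop := (Submodule.topologicalClosure_mono hker).trans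
    (Submodule.topologicalClosure_minimal _ le_rfl A.toCLM.isClosed_ker)
  rw [RSpace.topologicalClosure_span_kernelFun, top_le_iff] at htop
  ext1 r
  have : r ∈ LinearMap.ker (A.toCLM : RSpace X θ p →ₗ[ℝ] RSpace X θ p) := htop ▸ Submodule.mem_top
  exact this

end WeakLimits

/-! ### The representation of the compactified space of types -/

section TypeOperators

variable {X : Type*} [NormedAddCommGroup X] [MeasurableSpace X] [BorelSpace X]
  (θ : Set.Ioo (0 : ℝ) 1) (p : Set.Ioi (1 : ℝ))

theorem symmetrization_translation (x : X) (r : RSpace X θ p) :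
    symmetrization θ p (translation θ p (-x) r) = translation θ p x (symmetrization θ p r) := by
  refine RSpace.ext θ p fun y => ?_
  rw [symmetrization_apply, translation_apply, translation_apply, symmetrization_apply]
  congr 1
  abel

theorem translation_translation (x y : X) (r : RSpace X θ p) :
    translation θ p x (translation θ p y r) = translation θ p (x + y) r := by
  refine RSpace.ext θ p fun z => ?_
  rw [translation_apply, translation_apply, translation_apply, sub_sub]

variable [TopologicalSpace.SeparableSpace X]

theorem exists_tendsto_comap_nhds (hX : IsStable X) (σ : CompactTypeSpace X) :
    ∃ A, Tendsto (fun x => toWOT θ p (translation θ p x))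
      (comap (fun x : X => (degenerate x : CompactTypeSpace X)) (𝓝 σ)) (𝓝 A) := by
  induction σ using OnePoint.rec with
  | infty => exact ⟨0, tendsto_toWOT_cobounded θ p comap_coe_degenerate_nhds_infty_le⟩
  | coe σ =>
    rw [comap_coe_degenerate_nhds_coe]
    have := isDenseInducing_degenerate.comap_nhds_neBot σ
    obtain ⟨z, hz⟩ := exists_tendsto_dual_kernelFun θ p hX σ
    exact exists_tendsto_toWOT θ p hz

variable [NormedSpace ℝ X] [Nontrivial X]

/-- The operator `T_σ`: the extension of `x ↦ T_x` to the compactified space of types. -/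
def typeOperator (σ : CompactTypeSpace X) : RSpace X θ p →WOT[ℝ] RSpace X θ p :=
  isDenseInducing_coe_degenerate.extend (fun x => toWOT θ p (translation θ p x)) σ

theorem continuous_typeOperator (hX : IsStable X) :
    Continuous (typeOperator θ p : CompactTypeSpace X → _) :=
  isDenseInducing_coe_degenerate.continuous_extend (exists_tendsto_comap_nhds θ p hX)

theorem typeOperator_degenerate (hX : IsStable X) (x : X) :
    typeOperator θ p (degenerate x : CompactTypeSpace X) = toWOT θ p (translation θ p x) :=
  isDenseInducing_coe_degenerate.extend_eq' (exists_tendsto_comap_nhds θ p hX) x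

theorem typeOperator_infty : typeOperator θ p (OnePoint.infty : CompactTypeSpace X) = 0 :=
  isDenseInducing_coe_degenerate.extend_eq_of_tendsto
    (tendsto_toWOT_cobounded θ p comap_coe_degenerate_nhds_infty_le)

theorem tendsto_dual_typeOperator (hX : IsStable X) {ι : Type*} {l : Filter ι}
    {x : ι → TypeSpace X} {σ : TypeSpace X} (hx : Tendsto x l (𝓝 σ)) (r : RSpace X θ p)
    (φ : RSpace X θ p →L[ℝ] ℝ) :
    Tendsto (fun i => φ (typeOperator θ p (x i : CompactTypeSpace X) r)) l
      (𝓝 (φ (typeOperator θ p (σ : CompactTypeSpace X) r))) :=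
  ContinuousLinearMapWOT.tendsto_iff_forall_dual_apply_tendsto.1
    (((continuous_typeOperator θ p hX).comp OnePoint.continuous_coe).tendsto σ |>.comp hx) r φ

theorem tendsto_dual_translation (hX : IsStable X) {ι : Type*} {l : Filter ι}
    {x : ι → X} {σ : TypeSpace X} (hx : Tendsto (fun i => degenerate (x i)) l (𝓝 σ))
    (r : RSpace X θ p) (φ : RSpace X θ p →L[ℝ] ℝ) :
    Tendsto (fun i => φ (translation θ p (x i) r)) l
      (𝓝 (φ (typeOperator θ p (σ : CompactTypeSpace X) r))) := by
  refine (tendsto_dual_typeOperator θ p hX hx r φ).congr fun i => ?_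
  rw [typeOperator_degenerate θ p hX]
  rfl

theorem typeOperator_kernelFun_zero (hX : IsStable X) (σ : TypeSpace X) (y : X) :
    LionsPeetre.incl (PhiRange.incl X) θ p
      (typeOperator θ p (σ : CompactTypeSpace X) (RSpace.kernelFun θ p 0)) (-y) =
        Real.exp (-σ.1 y) := by
  have := isDenseInducing_degenerate.comap_nhds_neBot σ
  refine tendsto_nhds_unique (tendsto_dual_translation θ p hX
    (tendsto_comap (f := degenerate) (x := 𝓝 σ)) (RSpace.kernelFun θ p 0)
    ((BoundedContinuousFunction.evalCLM ℝ (-y)).comp (LionsPeetre.inclL (PhiRange.incl X) θ p))) ?_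
  refine ((Real.continuous_exp.tendsto _).comp (tendsto_degenerate_iff.1
    (tendsto_comap (f := degenerate) (x := 𝓝 σ)) y).neg).congr fun x => ?_
  change _ = LionsPeetre.incl (PhiRange.incl X) θ p
    (translation θ p x (RSpace.kernelFun θ p 0)) (-y)
  rw [RSpace.translation_kernelFun, RSpace.incl_kernelFun_apply, zero_add, sub_neg_eq_add, add_comm]
  rfl

theorem typeOperator_eq_zero_iff (hX : IsStable X) (σ : CompactTypeSpace X) :
    typeOperator θ p σ = 0 ↔ σ = OnePoint.infty := by
  refine ⟨fun h => ?_, fun h => h ▸ typeOperator_infty θ p⟩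
  induction σ using OnePoint.rec with
  | infty => rfl
  | coe σ =>
    have := typeOperator_kernelFun_zero θ p hX σ 0
    rw [h] at this
    exact absurd this.symm (Real.exp_ne_zero _)

theorem injective_typeOperator (hX : IsStable X) :
    Function.Injective (typeOperator θ p : CompactTypeSpace X → _) := by
  intro σ τ h
  induction σ using OnePoint.rec with
  | infty => exact ((typeOperator_eq_zero_iff θ p hX τ).1 (h ▸ typeOperator_infty θ p)).symm
  | coe σ =>
    induction τ using OnePoint.rec with
    | infty => exact (typeOperator_eq_zero_iff θ p hX σ).1 (h.trans (typeOperator_infty θ p))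
    | coe τ =>
      refine congrArg _ (Subtype.ext (funext fun y => ?_))
      have h1 := typeOperator_kernelFun_zero θ p hX σ y
      rw [h, typeOperator_kernelFun_zero θ p hX τ y] at h1
      exact (neg_injective (Real.exp_injective h1)).symm

theorem range_typeOperator (hX : IsStable X) :
    Set.range (typeOperator θ p : CompactTypeSpace X → _) = closedTranslations X θ p := by
  have hG : toWOT θ p '' (translationGroup X θ p : Set (RSpace X θ p ≃ₗᵢ[ℝ] RSpace X θ p)) =
      typeOperator θ p '' Set.range fun x : X => (degenerate x : CompactTypeSpace X) := by
    rw [← Set.range_comp, translationGroup, MonoidHom.coe_range, ← Set.range_comp]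
    refine congrArg Set.range (funext fun x : X => ?_)
    exact (typeOperator_degenerate θ p hX x).symm
  have hc := continuous_typeOperator θ p hX
  rw [closedTranslations, hG]
  refine Set.Subset.antisymm ?_ ?_
  · rw [← Set.image_univ, ← isDenseInducing_coe_degenerate.dense.closure_range]
    exact image_closure_subset_closure_image hc
  · exact closure_minimal (Set.image_subset_range _ _) (isCompact_range hc).isClosed

theorem symmetrization_mul_typeOperator (hX : IsStable X) (σ : CompactTypeSpace X) :
    toWOT θ p (symmetrization θ p) * typeOperator θ p (OnePoint.map Neg.neg σ) =
      typeOperator θ p σ * toWOT θ p (symmetrization θ p) := by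
  induction σ using OnePoint.rec with
  | infty => rw [OnePoint.map_infty, typeOperator_infty, mul_zero, zero_mul]
  | coe σ =>
    have := isDenseInducing_degenerate.comap_nhds_neBot σ
    refine ContinuousLinearMapWOT.ext_dual fun r φ => ?_
    have h := tendsto_dual_translation θ p hX (tendsto_neg_comap_degenerate σ) r
      (φ.comp (symmetrization (X := X) θ p : RSpace X θ p →L[ℝ] RSpace X θ p))
    refine tendsto_nhds_unique h ?_
    refine (tendsto_dual_translation θ p hX (tendsto_comap (f := degenerate) (x := 𝓝 σ))
      (symmetrization θ p r) φ).congr fun x => ?_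
    exact congrArg φ (symmetrization_translation θ p x r).symm

theorem typeOperator_conv (hX : IsStable X) (σ τ : TypeSpace X) :
    typeOperator θ p (conv hX σ τ : CompactTypeSpace X) =
      typeOperator θ p (σ : CompactTypeSpace X) * typeOperator θ p (τ : CompactTypeSpace X) := by
  obtain ⟨x, hx⟩ := σ.2
  obtain ⟨ρ, hρ, hlim⟩ := exists_translate_tendsto_conv hX σ τ hx
  have := isDenseInducing_degenerate.comap_nhds_neBot τ
  have hn : ∀ n r, typeOperator θ p (ρ n : CompactTypeSpace X) r =
      translation θ p (x n) (typeOperator θ p (τ : CompactTypeSpace X) r) := fun n r => by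
    refine (SeparatingDual.eq_iff_forall_dual_eq (R := ℝ)).2 fun φ => ?_
    refine tendsto_nhds_unique (tendsto_dual_translation θ p hX (hρ n) r φ) ?_
    refine (tendsto_dual_translation θ p hX (tendsto_comap (f := degenerate) (x := 𝓝 τ)) r
      (φ.comp (translation θ p (x n) : RSpace X θ p →L[ℝ] RSpace X θ p))).congr fun y => ?_
    exact congrArg φ (translation_translation θ p (x n) y r)
  refine ContinuousLinearMapWOT.ext_dual fun r φ => ?_
  refine tendsto_nhds_unique (tendsto_dual_typeOperator θ p hX hlim r φ) ?_
  refine (tendsto_dual_translation θ p hX (determines_iff_tendsto.1 hx)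
    (typeOperator θ p (τ : CompactTypeSpace X) r) φ).congr fun n => ?_
  rw [hn]

/-- The homeomorphism `σ ↦ T_σ` of the compactified space of types onto the weak operator closure
of the group of translations. -/
def typeHomeomorph (hX : IsStable X) : CompactTypeSpace X ≃ₜ closedTranslations X θ p :=
  Continuous.homeoOfEquivCompactToT2
    (f := (Equiv.ofInjective _ (injective_typeOperator θ p hX)).trans
      (Equiv.setCongr (range_typeOperator θ p hX)))
    (Continuous.subtype_mk (continuous_typeOperator θ p hX) _)

end TypeOperators

end StableBanach

end

theorem theorem4 {X : Type*} [NormedAddCommGroup X] [NormedSpace ℝ X] [CompleteSpace X]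
    [TopologicalSpace.SeparableSpace X] [Nontrivial X] [MeasurableSpace X] [BorelSpace X]
    (hX : StableBanach.IsStable X) (θ : Set.Ioo (0 : ℝ) 1) (p : Set.Ioi (1 : ℝ)) :
    ∃ T : StableBanach.CompactTypeSpace X ≃ₜ StableBanach.closedTranslations X θ p,
      (∀ x : X, (T (StableBanach.degenerate x : StableBanach.CompactTypeSpace X)).1 =
        StableBanach.toWOT θ p (StableBanach.translation θ p x)) ∧
      (∀ σ : StableBanach.CompactTypeSpace X, (T σ).1 = 0 ↔ σ = OnePoint.infty) ∧
      (∀ σ : StableBanach.CompactTypeSpace X,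
        StableBanach.toWOT θ p (StableBanach.symmetrization θ p) * (T (OnePoint.map Neg.neg σ)).1 =
          (T σ).1 * StableBanach.toWOT θ p (StableBanach.symmetrization θ p)) ∧
      (∀ σ τ : StableBanach.TypeSpace X,
        (T (StableBanach.conv hX σ τ : StableBanach.CompactTypeSpace X)).1 =
          (T (StableBanach.conv hX τ σ : StableBanach.CompactTypeSpace X)).1 ∧
        (T (StableBanach.conv hX τ σ : StableBanach.CompactTypeSpace X)).1 =
          (T (σ : StableBanach.CompactTypeSpace X)).1 *
            (T (τ : StableBanach.CompactTypeSpace X)).1) := by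
  refine ⟨StableBanach.typeHomeomorph θ p hX, StableBanach.typeOperator_degenerate θ p hX,
    StableBanach.typeOperator_eq_zero_iff θ p hX,
    StableBanach.symmetrization_mul_typeOperator θ p hX, fun σ τ => ⟨?_, ?_⟩⟩
  · rw [StableBanach.conv_comm]
  · rw [StableBanach.conv_comm]
    exact StableBanach.typeOperator_conv θ p hX σ τ
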